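/- Let $R\in\mathbb Z$ with $|R|>1$, let $B\subset\mathbb Z$ be a finite set with $0\in B$ and $N=|B|$ elements, put $\tau_b(x)=R^{-1}(x+b)$ for $b\in B$, $x\in\mathbb R$, and let $\mu_B$ be the invariant measure of $(\tau_b)_{b\in B}$, i.e. the unique Borel probability measure on $\mathbb R$ with $\int f\,d\mu_B=\frac1N\sum_{b\in B}\int f\circ\tau_b\,d\mu_B$ for all bounded Borel functions $f$. Let $m\ge1$, let $l_0,\dots,l_{m-1}\in\mathbb Z$ with $l_0=0$ and $\alpha_0,\dots,\alpha_{m-1}\in\mathbb C$ with $\alpha_0=1$, and assume that the matrix $$\frac1{\sqrt N}\left(e^{2\pi i R^{-1}b\,l_i}\alpha_i\right)_{0\le i\le m-1,\ b\in B}$$ is an isometry (it has orthonormal columns). For $t\in\mathbb R$ let $e_t(x)=e^{2\pi itx}$, $m_B(t)=\frac1N\sum_{b\in B}e^{2\pi ibt}$, $g_i(t)=R^{-1}(t-l_i)$ and $\nu_i(t)=\overline{\alpha_i}\,m_B(g_i(t))$. For a finite word $\omega=\omega_1\cdots\omega_n$ with digits in $\{0,\dots,m-1\}$ (the empty word is allowed)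 let $g_\omega=g_{\omega_n}\circ\cdots\circ g_{\omega_1}$ and $\nu_\omega(t)=\nu_{\omega_1}(t)\,\nu_{\omega_2}(g_{\omega_1}(t))\cdots\nu_{\omega_n}(g_{\omega_1\cdots\omega_{n-1}}(t))$. A set $S\subseteq\mathbb R$ is invariant if $g_i(t)\in S$ whenever $t\in S$ and $\nu_i(t)\neq0$; a minimal finite invariant set is a finite nonempty invariant set that has no nonempty proper invariant subset. A nonempty word $\beta=\beta_1\cdots\beta_p$ is a cycle word for $c$ if $g_\beta(c)=c$, $\nu_\beta(c)\ne0$, and $g_{\beta_1\cdots\beta_k}(c)\neq c$ for $1\le k<p$. Let $\Omega_c^{(0)}$ be the set of all finite words that do not end in a cycle word for $c$. Then there are only finitely many minimal finite invariant sets $M_1,\dots,M_p$, and for any choice of points $c_i\in M_i$, $i=1,\dots,p$, the family of weighted exponential functions $$\alpha_{\omega_1}\cdots\alpha_{\omega_n}\,e_{l_{\omega_1}+Rl_{\omega_2}+\cdots+R^{n-1}l_{\omega_n}+R^nc_i},\qquad \omega=\omega_1\cdots\omega_n\in\Omega_{c_i}^{(0)},\ i=1,\dots,p,$$ indexed by the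 pairs $(i,\omega)$, is a Parseval frame for $L^2(\mu_B)$: for every $v\in L^2(\mu_B)$, $\|v\|^2$ is the sum of the squared moduli of the inner products of $v$ with the members of the family. -/

import Mathlib

open MeasureTheory

namespace WeightedFourier

noncomputable section

/-! ### Parseval frames -/

/-- A family `(f i)` is a Parseval frame if `‖v‖² = ∑ |⟨v, f i⟩|²` for all `v`, with convergence
of the (nonnegative) series as part of the claim. -/
def IsParsevalFrame {ι H : Type*} [NormedAddCommGroup H] [InnerProductSpace ℂ H]
    (f : ι → H) : Prop :=
  ∀ v : H, HasSum (fun i => ‖inner ℂ (f i) v‖ ^ 2) (‖v‖ ^ 2)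

/-! ### The affine iterated function system and its invariant measure -/

/-- The contraction `τ_b(x) = R⁻¹ (x + b)`. -/
def tau (R b : ℤ) (x : ℝ) : ℝ := (R : ℝ)⁻¹ * (x + b)

/-- The probability measure `μ` is the invariant measure of `(τ_b)_{b ∈ B}`:
`∫ f dμ = (1/N) ∑_b ∫ f ∘ τ_b dμ` for all bounded Borel functions `f`, where `N = |B|`. -/
def IsInvariantMeasure (R : ℤ) (B : Finset ℤ) (μ : Measure ℝ) [IsProbabilityMeasure μ] : Prop :=
  ∀ f : ℝ → ℂ, Measurable f → (∃ C : ℝ, ∀ x, ‖f x‖ ≤ C) →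
    ∫ x, f x ∂μ = (1 / (B.card : ℂ)) * ∑ b ∈ B, ∫ x, f (tau R b x) ∂μ

/-! ### Exponential functions in `L²(μ)` -/

/-- `e_t(x) = e^{2πitx}`. -/
def expFun (t x : ℝ) : ℂ := Complex.exp (2 * Real.pi * Complex.I * (t * x))

theorem memLp_expFun (μ : Measure ℝ) [IsFiniteMeasure μ] (t : ℝ) : MemLp (expFun t) 2 μ := by
  have hc : Continuous (expFun t) := by unfold expFun; fun_prop
  refine MemLp.of_bound hc.aestronglyMeasurable 1 (Filter.Eventually.of_forall fun x => ?_)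
  have h : expFun t x = Complex.exp (((2 * Real.pi * (t * x) : ℝ) : ℂ) * Complex.I) := by
    unfold expFun; push_cast; ring_nf
  rw [h, Complex.norm_exp_ofReal_mul_I]

/-- The class of `e_t` in `L²(μ)`. -/
def expLp (μ : Measure ℝ) [IsFiniteMeasure μ] (t : ℝ) : Lp ℂ 2 μ :=
  (memLp_expFun μ t).toLp (expFun t)

/-! ### The random walk -/

/-- The matrix `N^{-1/2} (e^{2πi R⁻¹ b l_i} α_i)_{i, b}`. -/
def weightedMatrix (R : ℤ) (B : Finset ℤ) {m : ℕ} (l : Fin m → ℤ) (α : Fin m → ℂ) :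
    Matrix (Fin m) B ℂ :=
  fun i b => ((1 / Real.sqrt B.card : ℝ) : ℂ) *
    (Complex.exp (2 * Real.pi * Complex.I * ((R : ℂ)⁻¹ * (b : ℤ) * l i)) * α i)

/-- `m_B(t) = (1/N) ∑_{b ∈ B} e^{2πibt}`. -/
def mB (B : Finset ℤ) (t : ℝ) : ℂ :=
  (1 / (B.card : ℂ)) * ∑ b ∈ B, Complex.exp (2 * Real.pi * Complex.I * (b * t))

/-- `g_i(t) = R⁻¹ (t - l_i)`. -/
def g (R : ℤ) {m : ℕ} (l : Fin m → ℤ) (i : Fin m) (t : ℝ) : ℝ := (R : ℝ)⁻¹ * (t - l i)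

/-- `ν_i(t) = conj(α_i) m_B(g_i(t))`. -/
def nu (R : ℤ) (B : Finset ℤ) {m : ℕ} (l : Fin m → ℤ) (α : Fin m → ℂ) (i : Fin m) (t : ℝ) : ℂ :=
  (starRingEnd ℂ) (α i) * mB B (g R l i t)

/-- `g_ω = g_{ω_n} ∘ ⋯ ∘ g_{ω_1}` for a word `ω = ω_1 ⋯ ω_n`. -/
def gWord (R : ℤ) {m : ℕ} (l : Fin m → ℤ) : List (Fin m) → ℝ → ℝ
  | [], t => t
  | i :: ω, t => gWord R l ω (g R l i t)

/-- `ν_ω(t) = ν_{ω_1}(t) ν_{ω_2}(g_{ω_1}(t)) ⋯ ν_{ω_n}(g_{ω_{n-1}} ⋯ g_{ω_1}(t))`. -/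
def nuWord (R : ℤ) (B : Finset ℤ) {m : ℕ} (l : Fin m → ℤ) (α : Fin m → ℂ) :
    List (Fin m) → ℝ → ℂ
  | [], _ => 1
  | i :: ω, t => nu R B l α i t * nuWord R B l α ω (g R l i t)

/-- `S` is invariant: it contains `g_i(t)` for every `t ∈ S` and every `i` with `ν_i(t) ≠ 0`. -/
def IsInvariantSet (R : ℤ) (B : Finset ℤ) {m : ℕ} (l : Fin m → ℤ) (α : Fin m → ℂ)
    (S : Set ℝ) : Prop :=
  ∀ t ∈ S, ∀ i, nu R B l α i t ≠ 0 → g R l i t ∈ S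

/-- `S` is a finite set that is minimal among the nonempty invariant sets. -/
def IsMinimalFiniteInvariantSet (R : ℤ) (B : Finset ℤ) {m : ℕ} (l : Fin m → ℤ) (α : Fin m → ℂ)
    (S : Set ℝ) : Prop :=
  S.Finite ∧ Minimal (fun T : Set ℝ => T.Nonempty ∧ IsInvariantSet R B l α T) S

/-- `β` is a cycle word for `c`: nonempty, of nonzero weight, and it leads from `c` back to `c`
for the first time. -/
def IsCycleWord (R : ℤ) (B : Finset ℤ) {m : ℕ} (l : Fin m → ℤ) (α : Fin m → ℂ)
    (c : ℝ) (β : List (Fin m)) : Prop :=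
  β ≠ [] ∧ gWord R l β c = c ∧
    (∀ k, 0 < k → k < β.length → gWord R l (β.take k) c ≠ c) ∧ nuWord R B l α β c ≠ 0

/-- `Ω_c^{(0)}`: the finite words that do not end in a cycle word for `c`. -/
def Omega0 (R : ℤ) (B : Finset ℤ) {m : ℕ} (l : Fin m → ℤ) (α : Fin m → ℂ) (c : ℝ) :
    Set (List (Fin m)) :=
  {ω | ¬ ∃ β, IsCycleWord R B l α c β ∧ β <:+ ω}

/-- `l_{ω_1} + R l_{ω_2} + ⋯ + R^{n-1} l_{ω_n} + R^n c` for a word `ω = ω_1 ⋯ ω_n`. -/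
def wordFreq (R : ℤ) {m : ℕ} (l : Fin m → ℤ) (ω : List (Fin m)) (c : ℝ) : ℝ :=
  ∑ k : Fin ω.length, (R : ℝ) ^ (k : ℕ) * l (ω.get k) + (R : ℝ) ^ ω.length * c

/-- `α_{ω_1} ⋯ α_{ω_n} e_{l_{ω_1} + R l_{ω_2} + ⋯ + R^{n-1} l_{ω_n} + R^n c}` in `L²(μ)`. -/
def weightedExp (μ : Measure ℝ) [IsFiniteMeasure μ] (R : ℤ) {m : ℕ} (l : Fin m → ℤ)
    (α : Fin m → ℂ) (ω : List (Fin m)) (c : ℝ) : Lp ℂ 2 μ :=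
  (ω.map α).prod • expLp μ (wordFreq R l ω c)

end

/-! ### Existence of the invariant measure -/

section Existence

/-- The uniform distribution on `B`. -/
noncomputable def unif (B : Finset ℤ) : Measure B := ProbabilityTheory.uniformOn Set.univ

/-- Prepend a digit to a sequence of digits. -/
def cons {B : Finset ℤ} (p : B × (ℕ → B)) : ℕ → B
  | 0 => p.1
  | n + 1 => p.2 n

theorem measurable_cons {B : Finset ℤ} : Measurable (cons (B := B)) := by
  refine measurable_pi_iff.2 fun n => ?_
  cases n with
  | zero => exact measurable_fst
  | succ n => exact (measurable_pi_apply n).comp measurable_snd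

theorem map_cons {B : Finset ℤ} [IsProbabilityMeasure (unif B)] :
    ((unif B).prod (Measure.infinitePi fun _ : ℕ => unif B)).map cons =
      Measure.infinitePi fun _ : ℕ => unif B := by
  classical
  refine Measure.eq_infinitePi _ fun s t ht => ?_
  have hm : MeasurableSet ((s : Set ℕ).pi t) :=
    MeasurableSet.pi s.countable_toSet fun i _ => ht i
  rw [Measure.map_apply measurable_cons hm]
  set t' : ℕ → Set B := fun n => if n ∈ s then t n else Set.univ with ht'
  obtain ⟨n, hn⟩ : ∃ n, s ⊆ Finset.range (n + 1) :=
    ⟨s.sup id, fun i hi => Finset.mem_range.2 (Nat.lt_succ_of_le (Finset.le_sup (f := id) hi))⟩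
  have hpre : cons ⁻¹' ((s : Set ℕ).pi t) =
      t' 0 ×ˢ ((Finset.range n : Set ℕ).pi fun k => t' (k + 1)) := by
    ext ⟨b, x⟩
    simp only [Set.mem_preimage, Set.mem_pi, Finset.mem_coe, Set.mem_prod, ht', Finset.mem_range]
    constructor
    · intro h
      refine ⟨?_, fun k _ => ?_⟩
      · split_ifs with h0
        · exact h 0 h0
        · trivial
      · split_ifs with h0
        · exact h (k + 1) h0
        · trivial
    · rintro ⟨h0, h1⟩ i hi
      cases i with
      | zero => simpa [hi, cons] using h0
      | succ k =>
        have := h1 k (by have := Finset.mem_range.1 (hn hi); omega)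
        simpa [hi, cons] using this
  have hmt' : ∀ i, MeasurableSet (t' i) := fun i => by
    simp only [ht']; split_ifs
    · exact ht i
    · exact MeasurableSet.univ
  rw [hpre, Measure.prod_prod, Measure.infinitePi_pi _ (fun i _ => hmt' (i + 1))]
  calc unif B (t' 0) * ∏ k ∈ Finset.range n, unif B (t' (k + 1))
      = ∏ k ∈ Finset.range (n + 1), unif B (t' k) := by
        rw [Finset.prod_range_succ', mul_comm]
    _ = ∏ k ∈ s, unif B (t' k) := by
        refine (Finset.prod_subset hn fun i _ hi => ?_).symm
        simp [ht', hi]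
    _ = ∏ k ∈ s, unif B (t k) := Finset.prod_congr rfl fun i hi => by simp [ht', hi]

/-- The invariant measure exists, as the law of `∑_{k ≥ 1} R^{-k} b_k` for independent digits `b_k`
that are uniformly distributed on `B`. -/
theorem exists_isInvariantMeasure (R : ℤ) (hR : 1 < |R|) (B : Finset ℤ) (hB : B.Nonempty) :
    ∃ (μ : Measure ℝ) (_ : IsProbabilityMeasure μ), IsInvariantMeasure R B μ := by
  classical
  have : Nonempty B := hB.to_subtype
  have : IsProbabilityMeasure (unif B) :=
    ProbabilityTheory.instIsProbabilityMeasure_uniformOn_univ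
  set P : Measure (ℕ → B) := Measure.infinitePi fun _ : ℕ => unif B with hP
  have hR' : (1 : ℝ) < |(R : ℝ)| := by exact_mod_cast hR
  have hr : ‖(R : ℝ)⁻¹‖ < 1 := by
    rw [norm_inv, Real.norm_eq_abs]; exact inv_lt_one_of_one_lt₀ hR'
  obtain ⟨C, hC⟩ : ∃ C : ℝ, ∀ b : B, ‖((b : ℤ) : ℝ)‖ ≤ C := by
    obtain ⟨C, hC⟩ := (Set.finite_range fun b : B => ‖((b : ℤ) : ℝ)‖).bddAbove
    exact ⟨C, fun b => hC ⟨b, rfl⟩⟩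
  have hsum : ∀ x : ℕ → B, Summable fun k => (R : ℝ)⁻¹ ^ (k + 1) * ((x k : ℤ) : ℝ) := by
    intro x
    have hg : Summable fun k : ℕ => ‖(R : ℝ)⁻¹‖ ^ (k + 1) * C :=
      ((summable_nat_add_iff 1).2 (summable_geometric_of_lt_one (norm_nonneg _) hr)).mul_right C
    refine Summable.of_norm_bounded hg fun k => ?_
    rw [norm_mul, norm_pow]
    exact mul_le_mul_of_nonneg_left (hC _) (by positivity)
  set X : (ℕ → B) → ℝ := fun x => ∑' k, (R : ℝ)⁻¹ ^ (k + 1) * ((x k : ℤ) : ℝ) with hX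
  have hXm : Measurable X := by
    refine measurable_of_tendsto_metrizable (f := fun n x =>
      ∑ k ∈ Finset.range n, (R : ℝ)⁻¹ ^ (k + 1) * ((x k : ℤ) : ℝ)) (fun n => ?_) ?_
    · refine Finset.measurable_sum _ fun k _ => ?_
      have : Measurable fun b : B => ((b : ℤ) : ℝ) := measurable_of_finite _
      exact (this.comp (measurable_pi_apply k)).const_mul _
    · exact tendsto_pi_nhds.2 fun x => (hsum x).hasSum.tendsto_sum_nat
  have hcons : ∀ (b : B) (x : ℕ → B), X (cons (b, x)) = tau R b (X x) := by
    intro b x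
    simp only [hX, tau]
    rw [(hsum (cons (b, x))).tsum_eq_zero_add, add_comm ((∑' k, _ : ℝ)), mul_add, ← tsum_mul_left]
    simp only [cons, zero_add, pow_one]
    congr 1
    exact tsum_congr fun k => by ring
  refine ⟨P.map X, Measure.isProbabilityMeasure_map hXm.aemeasurable, fun f hf ⟨D, hD⟩ => ?_⟩
  have hτ : ∀ b : ℤ, Measurable (tau R b) := fun b => by unfold tau; fun_prop
  rw [integral_map hXm.aemeasurable hf.aestronglyMeasurable]
  have h1 : ∫ x, f (X x) ∂P = ∫ p, f (X (cons p)) ∂((unif B).prod P) := by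
    rw [← integral_map measurable_cons.aemeasurable (f := fun x => f (X x))
      (hf.comp hXm).aestronglyMeasurable, map_cons]
  have hint : Integrable (fun p => f (X (cons p))) ((unif B).prod P) :=
    Integrable.of_bound (hf.comp (hXm.comp measurable_cons)).aestronglyMeasurable D
      (Filter.Eventually.of_forall fun _ => hD _)
  rw [h1, integral_prod _ hint, integral_fintype (Integrable.of_finite), Finset.mul_sum,
    ← Finset.sum_coe_sort B]
  refine Finset.sum_congr rfl fun b _ => ?_
  rw [integral_map hXm.aemeasurable (f := fun x => f (tau R b x))
    (hf.comp (hτ b)).aestronglyMeasurable]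
  have hb : (unif B).real {b} = 1 / (B.card : ℝ) := by
    rw [measureReal_def, unif, ProbabilityTheory.uniformOn_univ]
    simp
  rw [hb]
  simp only [hcons]
  rw [Complex.real_smul]
  push_cast
  rfl

end Existence

end WeightedFourier

/-! The transfer operators `T_i v = conj(α_i) N⁻¹ ∑_b (e_{-l_i} v) ∘ τ_b` satisfy
`∑_i ‖T_i v‖² = ‖v‖²` and `T_i e_t = ν_i(t) e_{g_i(t)}`, so the `|ν_i(t)|²` are the transition
probabilities of a random walk on `ℝ`. Points of finite invariant sets lie in the lattice dual to
`B` and their exponentials are orthonormal; as `t ↦ e_t` is continuous, this leaves only finitely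
many minimal sets. The walk in a minimal set visits each of its points almost surely.

By this recurrence the frame sums `Q(v)` satisfy `Q(v) = ∑_i Q(T_i v)`: prepending a letter to the
words of `Ω_c^{(0)}` also produces the cycle words, whose total weight `1` accounts for the empty
word. Iterating from Bessel's inequality for the orthonormal exponentials gives `Q(v) ≤ ‖v‖²`.
Then `d(t) = 1 - Q(e_t)` is nonnegative, real analytic, harmonic for the walk, and zero at every
`c_i`. On a large interval that the walk does not leave, the points where `d` is maximal form an
invariant set, which either contains a minimal set or is infinite, and then `d` is constant. In
both cases `d = 0`, so the analysis operator `v ↦ (⟨f, v⟩)_f` preserves the norms of all `e_t`.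
Being a contraction, it preserves the norm on their span, which is dense.
-/

namespace WeightedFourier

open Filter Topology Matrix BoundedContinuousFunction
open scoped ENNReal NNReal ComplexConjugate

/-! ### Finite sums, series and Hilbert spaces -/

theorem eq_of_sum_mul_eq {ι 𝕜 : Type*} [Fintype ι] [Semifield 𝕜] [LinearOrder 𝕜]
    [IsStrictOrderedRing 𝕜] {w u : ι → 𝕜} {M : 𝕜} (hw : ∀ i, 0 ≤ w i) (hw1 : ∑ i, w i = 1)
    (hu : ∀ i, w i ≠ 0 → u i ≤ M) (h : ∑ i, w i * u i = M) {i : ι} (hi : w i ≠ 0) : u i = M := by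
  have hle : ∀ j ∈ Finset.univ, w j * u j ≤ w j * M := fun j _ => by
    rcases eq_or_ne (w j) 0 with hj | hj
    · simp only [hj, zero_mul, le_refl]
    · exact mul_le_mul_of_nonneg_left (hu j hj) (hw j)
  have heq : ∑ j, w j * u j = ∑ j, w j * M := by rw [h, ← Finset.sum_mul, hw1, one_mul]
  exact mul_left_cancel₀ hi ((Finset.sum_eq_sum_iff_of_le hle).1 heq i (Finset.mem_univ i))

theorem eq_one_of_one_le_sum_fiber {X : Type*} [DecidableEq X] {M : Finset X} {φ : X → X}
    {w : X → ℝ} (hw : ∀ y ∈ M, w y ≤ 1) (h : ∀ x ∈ M, 1 ≤ ∑ y ∈ M with φ y = x, w y) :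
    ∀ y ∈ M, w y = 1 := by
  have hcard : (M.card : ℝ) ≤ ∑ y ∈ M with φ y ∈ M, w y := by
    rw [← Finset.sum_fiberwise_eq_sum_filter]
    simpa using Finset.sum_le_sum h
  have hfilter : {y ∈ M | φ y ∈ M} = M := by
    refine Finset.eq_of_subset_of_card_le (Finset.filter_subset _ _) ?_
    have := hcard.trans (Finset.sum_le_sum fun y hy => hw y (Finset.mem_of_mem_filter y hy))
    simpa using this
  rw [hfilter] at hcard
  refine (Finset.sum_eq_sum_iff_of_le hw).1 (le_antisymm (Finset.sum_le_sum hw) ?_)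
  simpa using hcard

theorem eq_of_card_le_norm_sum {ι E : Type*} [NormedAddCommGroup E] [NormedSpace ℝ E]
    [StrictConvexSpace ℝ E] {s : Finset ι} {f : ι → E} (hf : ∀ i ∈ s, ‖f i‖ = 1)
    (h : (s.card : ℝ) ≤ ‖∑ i ∈ s, f i‖) {i j : ι} (hi : i ∈ s) (hj : j ∈ s) : f i = f j := by
  classical
  rcases eq_or_ne i j with rfl | hij
  · rfl
  have hj' : j ∈ s.erase i := Finset.mem_erase.2 ⟨hij.symm, hj⟩
  have hcard : (((s.erase i).erase j).card : ℝ) = s.card - 2 := by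
    have h1 := Finset.card_erase_add_one hi
    have h2 := Finset.card_erase_add_one hj'
    rw [← h1, ← h2]
    push_cast
    ring
  have hrest : ‖∑ k ∈ (s.erase i).erase j, f k‖ ≤ s.card - 2 := by
    rw [← hcard]
    refine (norm_sum_le_of_le _ fun k hk => (hf k ?_).le).trans_eq ?_
    · exact Finset.mem_of_mem_erase (Finset.mem_of_mem_erase hk)
    · rw [Finset.sum_const, nsmul_one]
  rw [← Finset.add_sum_erase s f hi, ← Finset.add_sum_erase _ f hj', ← add_assoc] at h
  refine eq_of_norm_eq_of_norm_add_eq ((hf i hi).trans (hf j hj).symm)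
    (le_antisymm (norm_add_le _ _) ?_)
  rw [hf i hi, hf j hj]
  linarith [norm_add_le (f i + f j) (∑ k ∈ (s.erase i).erase j, f k)]

theorem tsum_list_eq_nil_add_sum_cons {ι : Type*} [Fintype ι] (q : List ι → ℝ≥0∞) :
    ∑' ω, q ω = q [] + ∑ i, ∑' ω, q (i :: ω) := by
  let e : Unit ⊕ ι × List ι ≃ List ι :=
    { toFun := Sum.elim (fun _ => []) fun p => p.1 :: p.2
      invFun := fun ω => ω.casesOn (.inl ()) fun i ω => .inr (i, ω)
      left_inv := by rintro (_ | _) <;> rfl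
      right_inv := by rintro (_ | _) <;> rfl }
  rw [← e.tsum_eq, ENNReal.summable.tsum_sum ENNReal.summable, tsum_fintype,
    Fintype.sum_unique, ← tsum_fintype (L := .unconditional ι)]
  exact congrArg (q [] + ·) (ENNReal.tsum_prod (f := fun i ω => q (i :: ω)))

theorem tendsto_tsum_ite_le {ι : Type*} (f : ι → ℝ≥0∞) (len : ι → ℕ) :
    Tendsto (fun n => ∑' a, if len a ≤ n then f a else 0) atTop (𝓝 (∑' a, f a)) := by
  have hmono : Monotone fun n => ∑' a, if len a ≤ n then f a else 0 := fun n k hnk =>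
    ENNReal.tsum_le_tsum fun a => by
      split_ifs with h h' <;> first | exact le_rfl | exact zero_le | exact absurd (h.trans hnk) h'
  convert tendsto_atTop_iSup hmono using 2
  refine le_antisymm ?_ (iSup_le fun n => ENNReal.tsum_le_tsum fun a => by split_ifs <;> simp)
  rw [ENNReal.tsum_eq_iSup_sum]
  refine iSup_le fun s => le_iSup_of_le (s.sup len) ?_
  calc ∑ a ∈ s, f a = ∑ a ∈ s, if len a ≤ s.sup len then f a else 0 :=
        Finset.sum_congr rfl fun a ha => (if_pos (Finset.le_sup ha)).symm
    _ ≤ ∑' a, if len a ≤ s.sup len then f a else 0 := ENNReal.sum_le_tsum s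

theorem sum_norm_sq_mulVec_of_isometry {𝕜 ι κ : Type*} [RCLike 𝕜] [Fintype ι] [Fintype κ]
    [DecidableEq κ] {A : Matrix ι κ 𝕜} (hA : Aᴴ * A = 1) (v : κ → 𝕜) :
    ∑ i, ‖(A *ᵥ v) i‖ ^ 2 = ∑ j, ‖v j‖ ^ 2 := by
  have hdot : star (A *ᵥ v) ⬝ᵥ A *ᵥ v = star v ⬝ᵥ v := by
    rw [star_mulVec, dotProduct_mulVec, vecMul_vecMul, hA, vecMul_one]
  simp only [dotProduct, Pi.star_apply, RCLike.star_def, RCLike.conj_mul] at hdot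
  exact_mod_cast hdot

theorem finite_of_pairwise_inner_eq_zero {X 𝕜 E : Type*} [TopologicalSpace X] [RCLike 𝕜]
    [NormedAddCommGroup E] [InnerProductSpace 𝕜 E] {f : X → E} (hf : Continuous f)
    (hf0 : ∀ x, f x ≠ 0) {K s : Set X} (hK : IsCompact K) (hsK : s ⊆ K)
    (hs : s.Pairwise fun x y => inner 𝕜 (f x) (f y) = 0) : s.Finite := by
  have hU : ∀ x, ∃ U ∈ 𝓝 x, ∀ y ∈ U, ∀ z ∈ U, inner 𝕜 (f y) (f z) ≠ 0 := fun x => by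
    have hcont : ContinuousAt (fun p : X × X => inner 𝕜 (f p.1) (f p.2)) (x, x) := by fun_prop
    have hne := hcont.eventually_ne (inner_self_ne_zero.2 (hf0 x))
    rw [nhds_prod_eq] at hne
    obtain ⟨U, hU, hUne⟩ := mem_prod_same_iff.1 hne
    exact ⟨U, hU, fun y hy z hz => hUne (Set.mk_mem_prod hy hz)⟩
  choose U hU hUne using hU
  obtain ⟨t, -, ht⟩ := hK.elim_nhds_subcover U fun x _ => hU x
  refine Set.Finite.subset (s := ⋃ x ∈ t, s ∩ U x) (t.finite_toSet.biUnion fun x _ => ?_)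
    fun y hy => Set.mem_iUnion₂.2 ?_
  · refine Set.Subsingleton.finite fun y hy z hz => ?_
    by_contra hyz
    exact hUne x y hy.2 z hz.2 (hs hy.1 hz.1 hyz)
  · obtain ⟨x, hx, hyx⟩ := Set.mem_iUnion₂.1 (ht (hsK hy))
    exact ⟨x, hx, hy, hyx⟩

theorem sum_enorm_sq_eq_iff {ι E F : Type*} [SeminormedAddGroup E] [SeminormedAddGroup F]
    {s : Finset ι} {f : ι → E} {x : F} :
    ∑ i ∈ s, ‖f i‖ₑ ^ 2 = ‖x‖ₑ ^ 2 ↔ ∑ i ∈ s, ‖f i‖ ^ 2 = ‖x‖ ^ 2 := by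
  simp only [enorm_eq_nnnorm, ← coe_nnnorm]
  norm_cast

theorem tsum_enorm_sq_of_hasSum {ι E F : Type*} [SeminormedAddGroup E] [SeminormedAddGroup F]
    {f : ι → E} {x : F} (h : HasSum (fun i => ‖f i‖ ^ 2) (‖x‖ ^ 2)) :
    ∑' i, ‖f i‖ₑ ^ 2 = ‖x‖ₑ ^ 2 := by
  have h' : HasSum (fun i => ‖f i‖₊ ^ 2) (‖x‖₊ ^ 2) := NNReal.hasSum_coe.1 (by simpa using h)
  simpa [enorm_eq_nnnorm] using (ENNReal.hasSum_coe.2 h').tsum_eq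

theorem exists_analysis_operator {ι 𝕜 E : Type*} [RCLike 𝕜] [NormedAddCommGroup E]
    [InnerProductSpace 𝕜 E] (f : ι → E) (hf : ∀ v, ∑' i, ‖inner 𝕜 (f i) v‖ₑ ^ 2 ≤ ‖v‖ₑ ^ 2) :
    ∃ A : E →L[𝕜] lp (fun _ : ι => 𝕜) 2, (∀ v, ‖A v‖ ≤ ‖v‖) ∧
      ∀ v, HasSum (fun i => ‖inner 𝕜 (f i) v‖ ^ 2) (‖A v‖ ^ 2) := by
  have hsum : ∀ v, Summable fun i => ‖inner 𝕜 (f i) v‖ ^ 2 := fun v => by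
    have hfin : ∑' i, ‖inner 𝕜 (f i) v‖ₑ ^ 2 ≠ ⊤ := ne_top_of_le_ne_top (by simp) (hf v)
    simpa using ENNReal.summable_toReal hfin
  have hmem : ∀ v, Memℓp (fun i => inner 𝕜 (f i) v) 2 := fun v =>
    memℓp_gen (by simpa using hsum v)
  let A : E →ₗ[𝕜] lp (fun _ : ι => 𝕜) 2 :=
    { toFun := fun v => ⟨_, hmem v⟩
      map_add' := fun u v => by ext i; exact inner_add_right _ _ _
      map_smul' := fun a v => by ext i; exact inner_smul_right _ _ _ }
  have hnorm : ∀ v, HasSum (fun i => ‖inner 𝕜 (f i) v‖ ^ 2) (‖A v‖ ^ 2) := fun v => by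
    simpa [A] using lp.hasSum_norm (p := 2) (by norm_num) (A v)
  have hle : ∀ v, ‖A v‖ ≤ ‖v‖ := fun v => by
    have hv := ENNReal.toReal_mono (by simp) (hf v)
    rw [ENNReal.tsum_toReal_eq (by simp)] at hv
    simp only [ENNReal.toReal_pow, toReal_enorm, (hnorm v).tsum_eq] at hv
    exact (sq_le_sq₀ (norm_nonneg _) (norm_nonneg _)).1 hv
  exact ⟨A.mkContinuous 1 (by simpa using hle), hle, hnorm⟩

theorem norm_map_eq_of_contraction {𝕜 E F : Type*} [RCLike 𝕜] [NormedAddCommGroup E]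
    [InnerProductSpace 𝕜 E] [NormedAddCommGroup F] [InnerProductSpace 𝕜 F] {A : E →L[𝕜] F}
    (hA : ∀ v, ‖A v‖ ≤ ‖v‖) {s : Set E} (hs : (Submodule.span 𝕜 s).topologicalClosure = ⊤)
    (h : ∀ v ∈ s, ‖A v‖ = ‖v‖) (v : E) : ‖A v‖ = ‖v‖ := by
  let M : Submodule 𝕜 E :=
    { carrier := {v | ‖A v‖ = ‖v‖}
      zero_mem' := by simp
      add_mem' := fun {u v} (hu : ‖A u‖ = ‖u‖) (hv : ‖A v‖ = ‖v‖) => by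
        -- By the parallelogram law, a loss of norm at `u + v` would be a gain at `u - v`.
        have hE := parallelogram_law_with_norm 𝕜 u v
        have hF := parallelogram_law_with_norm 𝕜 (A u) (A v)
        rw [← map_add, ← map_sub, hu, hv] at hF
        have hsub := mul_self_le_mul_self (norm_nonneg _) (hA (u - v))
        exact le_antisymm (hA _) ((mul_self_le_mul_self_iff (norm_nonneg _) (norm_nonneg _)).2
          (by linarith))
      smul_mem' := fun a v (hv : ‖A v‖ = ‖v‖) => by
        change ‖A (a • v)‖ = ‖a • v‖
        rw [map_smul, norm_smul, norm_smul, hv] }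
  have hclosed : IsClosed (M : Set E) := isClosed_eq (by fun_prop) (by fun_prop)
  have hsM : s ⊆ M := h
  have htop := Submodule.topologicalClosure_minimal _ (Submodule.span_le.2 hsM) hclosed
  rw [hs] at htop
  exact htop trivial

theorem eq_const_of_infinite_level_set {𝕜 E : Type*} [NontriviallyNormedField 𝕜]
    [PreconnectedSpace 𝕜] [NormedAddCommGroup E] [NormedSpace 𝕜 E] {f : 𝕜 → E}
    (hf : AnalyticOnNhd 𝕜 f Set.univ) {y : E} {K : Set 𝕜} (hK : IsCompact K)
    (hinf : {x ∈ K | f x = y}.Infinite) (x : 𝕜) : f x = y := by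
  obtain ⟨a, -, ha⟩ := hinf.exists_accPt_of_subset_isCompact hK fun x hx => hx.1
  have hfreq : ∃ᶠ x in 𝓝[≠] a, f x = y := (accPt_iff_frequently_nhdsNE.1 ha).mono fun x hx => hx.2
  exact hf.eqOn_of_preconnected_of_frequently_eq analyticOnNhd_const isPreconnected_univ
    (Set.mem_univ a) hfreq (Set.mem_univ x)

variable {R : ℤ} {B : Finset ℤ} {m : ℕ} {l : Fin m → ℤ} {α : Fin m → ℂ}
variable {μ : Measure ℝ} [IsProbabilityMeasure μ]

/-! ### Exponentials -/

theorem expFun_eq_fourierChar (t x : ℝ) : expFun t x = Real.fourierChar (t * x) := by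
  rw [expFun, Real.fourierChar_apply]
  push_cast
  ring_nf

theorem norm_expFun (t x : ℝ) : ‖expFun t x‖ = 1 := by
  rw [expFun_eq_fourierChar, Circle.norm_coe]

theorem continuous_expFun (t : ℝ) : Continuous (expFun t) := by
  unfold expFun
  fun_prop

theorem expFun_comm (s t : ℝ) : expFun s t = expFun t s := by
  simp only [expFun_eq_fourierChar, mul_comm]

theorem expFun_add (s t x : ℝ) : expFun (s + t) x = expFun s x * expFun t x := by
  simp only [expFun_eq_fourierChar, add_mul, AddChar.map_add_eq_mul, Circle.coe_mul]

theorem conj_expFun (t x : ℝ) : conj (expFun t x) = expFun (-t) x := by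
  simp only [expFun_eq_fourierChar, neg_mul, AddChar.map_neg_eq_inv, Circle.coe_inv_eq_conj]

theorem expFun_eq_one_iff {t x : ℝ} : expFun t x = 1 ↔ ∃ k : ℤ, t * x = k := by
  rw [expFun, Complex.exp_eq_one_iff]
  refine exists_congr fun k => ?_
  rw [mul_comm (2 * Real.pi * Complex.I : ℂ), mul_left_inj' Complex.two_pi_I_ne_zero]
  exact_mod_cast Iff.rfl

theorem expFun_tau (R b : ℤ) (t x : ℝ) :
    expFun t (tau R b x) = expFun b ((R : ℝ)⁻¹ * t) * expFun ((R : ℝ)⁻¹ * t) x := by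
  rw [expFun_comm b, expFun, expFun, expFun, tau, ← Complex.exp_add]
  push_cast
  ring_nf

theorem mB_eq_sum_expFun (B : Finset ℤ) (t : ℝ) :
    mB B t = (1 / (B.card : ℂ)) * ∑ b ∈ B, expFun b t := by
  simp only [mB, expFun, Complex.ofReal_intCast]

theorem weightedMatrix_apply (R : ℤ) (B : Finset ℤ) {m : ℕ} (l : Fin m → ℤ) (α : Fin m → ℂ)
    (i : Fin m) (b : B) : weightedMatrix R B l α i b =
      ((1 / Real.sqrt B.card : ℝ) : ℂ) * (expFun ((R : ℝ)⁻¹ * l i) (b : ℤ) * α i) := by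
  rw [weightedMatrix, expFun]
  push_cast
  ring_nf

/-- `b c` is an integer for all `b ∈ B`, i.e. `c` lies in the lattice dual to the one generated
by `B`. -/
def IsDual (B : Finset ℤ) (c : ℝ) : Prop := ∀ b ∈ B, ∃ k : ℤ, (b : ℝ) * c = k

theorem isDual_iff_expFun {B : Finset ℤ} {c : ℝ} : IsDual B c ↔ ∀ b ∈ B, expFun b c = 1 := by
  simp only [IsDual, expFun_eq_one_iff]

/-! ### Change of variables for the invariant measure -/

theorem measurable_tau (R b : ℤ) : Measurable (tau R b) := by
  unfold tau
  fun_prop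

theorem IsInvariantMeasure.sum_map (hμ : IsInvariantMeasure R B μ) (hB : B.Nonempty) :
    ∑ b ∈ B, μ.map (tau R b) = (B.card : ℝ≥0∞) • μ := by
  ext A hA
  have hN : (B.card : ℂ) ≠ 0 := by exact_mod_cast hB.card_ne_zero
  have hA1 := hμ (A.indicator fun _ => 1) (measurable_const.indicator hA)
    ⟨1, fun x => (norm_indicator_le_norm_self _ x).trans_eq norm_one⟩
  have hcomp : ∀ b : ℤ, (fun x => A.indicator (fun _ => (1 : ℂ)) (tau R b x)) =
      (tau R b ⁻¹' A).indicator fun _ => 1 := fun b => rfl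
  simp only [hcomp, integral_indicator_const _ hA,
    integral_indicator_const _ (measurable_tau R _ hA), Complex.real_smul, mul_one] at hA1
  rw [one_div, eq_inv_mul_iff_mul_eq₀ hN] at hA1
  have hreal : (B.card : ℝ) * μ.real A = ∑ b ∈ B, μ.real (tau R b ⁻¹' A) := by exact_mod_cast hA1
  simp only [Measure.coe_finsetSum, Finset.sum_apply, Measure.smul_apply, smul_eq_mul,
    Measure.map_apply (measurable_tau R _) hA]
  rw [← ENNReal.toReal_eq_toReal_iff' (by simp) (by finiteness),
    ENNReal.toReal_sum (by simp), ENNReal.toReal_mul, ENNReal.toReal_natCast]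
  exact hreal.symm

theorem IsInvariantMeasure.map_le (hμ : IsInvariantMeasure R B μ) {b : ℤ} (hb : b ∈ B) :
    μ.map (tau R b) ≤ (B.card : ℝ≥0∞) • μ := by
  classical
  rw [← hμ.sum_map ⟨b, hb⟩, ← Finset.add_sum_erase _ _ hb]
  exact Measure.le_add_right le_rfl

theorem IsInvariantMeasure.quasiMeasurePreserving_tau (hμ : IsInvariantMeasure R B μ) {b : ℤ}
    (hb : b ∈ B) : Measure.QuasiMeasurePreserving (tau R b) μ μ :=
  ⟨measurable_tau R b, (Measure.absolutelyContinuous_of_le (hμ.map_le hb)).trans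
    Measure.smul_absolutelyContinuous⟩

theorem IsInvariantMeasure.memLp_comp_tau {E : Type*} [NormedAddCommGroup E]
    (hμ : IsInvariantMeasure R B μ) {b : ℤ} (hb : b ∈ B) {f : ℝ → E} {p : ℝ≥0∞}
    (hf : MemLp f p μ) : MemLp (fun x => f (tau R b x)) p μ :=
  ((hf.smul_measure (by simp : (B.card : ℝ≥0∞) ≠ ⊤)).mono_measure
    (hμ.map_le hb)).comp_of_map (measurable_tau R b).aemeasurable

theorem IsInvariantMeasure.integrable_comp_tau {E : Type*} [NormedAddCommGroup E]
    (hμ : IsInvariantMeasure R B μ) {b : ℤ} (hb : b ∈ B) {f : ℝ → E} (hf : Integrable f μ) :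
    Integrable (fun x => f (tau R b x)) μ :=
  memLp_one_iff_integrable.1 (hμ.memLp_comp_tau hb (memLp_one_iff_integrable.2 hf))

theorem IsInvariantMeasure.integral_eq_average {E : Type*} [NormedAddCommGroup E]
    [NormedSpace ℝ E] (hμ : IsInvariantMeasure R B μ) (hB : B.Nonempty) {f : ℝ → E}
    (hf : Integrable f μ) :
    ∫ x, f x ∂μ = (B.card : ℝ)⁻¹ • ∫ x, ∑ b ∈ B, f (tau R b x) ∂μ := by
  have hN : (B.card : ℝ) ≠ 0 := by exact_mod_cast hB.card_ne_zero
  have hf' : Integrable f ((B.card : ℝ≥0∞) • μ) := hf.smul_measure (by simp)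
  have hsmul := integral_smul_measure (μ := μ) f (B.card : ℝ≥0∞)
  rw [← hμ.sum_map hB, integral_finsetSum_measure
    (fun b hb => hf'.mono_measure (hμ.map_le hb)), ENNReal.toReal_natCast] at hsmul
  rw [integral_finsetSum _ fun b hb => hμ.integrable_comp_tau hb hf, eq_inv_smul_iff₀ hN,
    ← hsmul]
  refine Finset.sum_congr rfl fun b hb => integral_map (measurable_tau R b).aemeasurable ?_
  exact (hf'.mono_measure (hμ.map_le hb)).aestronglyMeasurable

theorem norm_sq_eq_integral {X : Type*} [MeasurableSpace X] {ρ : Measure X} (v : Lp ℂ 2 ρ) :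
    ‖v‖ ^ 2 = ∫ x, ‖v x‖ ^ 2 ∂ρ := by
  rw [← inner_self_eq_norm_sq (𝕜 := ℂ) v, L2.inner_def, ← integral_re (L2.integrable_inner v v)]
  simp only [inner_self_eq_norm_sq]

theorem coeFn_expLp {ρ : Measure ℝ} [IsFiniteMeasure ρ] (t : ℝ) : expLp ρ t =ᵐ[ρ] expFun t :=
  (memLp_expFun ρ t).coeFn_toLp

theorem inner_expLp {ρ : Measure ℝ} [IsFiniteMeasure ρ] (t : ℝ) (v : Lp ℂ 2 ρ) :
    inner ℂ (expLp ρ t) v = ∫ x, expFun (-t) x * v x ∂ρ := by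
  rw [L2.inner_def]
  refine integral_congr_ae ?_
  filter_upwards [coeFn_expLp t] with x hx
  rw [hx, RCLike.inner_apply, conj_expFun, mul_comm]

theorem norm_expLp (t : ℝ) : ‖expLp μ t‖ = 1 := by
  have h : ∫ x, ‖expLp μ t x‖ ^ 2 ∂μ = ∫ _, 1 ∂μ := by
    refine integral_congr_ae ?_
    filter_upwards [coeFn_expLp (ρ := μ) t] with x hx
    rw [hx, norm_expFun, one_pow]
  rw [← norm_sq_eq_integral, integral_const, probReal_univ, one_smul] at h
  exact (pow_eq_one_iff_of_nonneg (norm_nonneg _) two_ne_zero).1 h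

theorem memLp_expFun_mul {ρ : Measure ℝ} {p : ℝ≥0∞} (t : ℝ) {v : ℝ → ℂ} (hv : MemLp v p ρ) :
    MemLp (fun x => expFun t x * v x) p ρ :=
  hv.of_le ((continuous_expFun t).aestronglyMeasurable.mul hv.1)
    (Eventually.of_forall fun x => by rw [norm_mul, norm_expFun, one_mul])

/-! ### Transfer operators -/

/-- The transfer operator `v ↦ conj(α_i) N⁻¹ ∑_b (e_{-l_i} v) ∘ τ_b` on functions. -/
noncomputable def transferFun (R : ℤ) (B : Finset ℤ) {m : ℕ} (l : Fin m → ℤ) (α : Fin m → ℂ)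
    (i : Fin m) (v : ℝ → ℂ) (x : ℝ) : ℂ :=
  conj (α i) * ((1 / (B.card : ℂ)) * ∑ b ∈ B, expFun (-(l i : ℝ)) (tau R b x) * v (tau R b x))

theorem transferFun_expFun (i : Fin m) (t x : ℝ) :
    transferFun R B l α i (expFun t) x = nu R B l α i t * expFun (g R l i t) x := by
  have hg : (R : ℝ)⁻¹ * (-(l i : ℝ) + t) = g R l i t := by rw [g]; ring
  simp only [transferFun, nu, mB_eq_sum_expFun, ← expFun_add]
  simp only [expFun_tau, hg]
  rw [← Finset.sum_mul]
  ring

theorem expFun_neg_mul_transferFun (hR : R ≠ 0) {c : ℝ} (hc : IsDual B c) (i : Fin m) (v : ℝ → ℂ)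
    (x : ℝ) : expFun (-c) x * transferFun R B l α i v x = conj (α i) * ((1 / (B.card : ℂ)) *
      ∑ b ∈ B, expFun (-(l i + R * c)) (tau R b x) * v (tau R b x)) := by
  have hτ : ∀ b ∈ B, expFun (-(R * c)) (tau R b x) = expFun (-c) x := fun b hb => by
    have hR' : (R : ℝ) ≠ 0 := by exact_mod_cast hR
    have hb1 : expFun b (-c) = 1 := by
      rw [expFun_comm, ← conj_expFun, expFun_comm, isDual_iff_expFun.1 hc b hb, map_one]
    rw [expFun_tau, mul_neg, inv_mul_cancel_left₀ hR', hb1, one_mul]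
  rw [transferFun, mul_left_comm, mul_left_comm (expFun (-c) x), Finset.mul_sum]
  congr 2
  refine Finset.sum_congr rfl fun b hb => ?_
  rw [neg_add, expFun_add, hτ b hb]
  ring

theorem transferFun_eq_mulVec (i : Fin m) (v : ℝ → ℂ) (x : ℝ) :
    transferFun R B l α i v x = expFun (-((R : ℝ)⁻¹ * l i)) x * (((1 / Real.sqrt B.card : ℝ) : ℂ) *
      conj ((weightedMatrix R B l α *ᵥ fun b => conj (v (tau R b x))) i)) := by
  have hsqrt : (1 / (B.card : ℂ)) =
      ((1 / Real.sqrt B.card : ℝ) : ℂ) * ((1 / Real.sqrt B.card : ℝ) : ℂ) := by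
    rw [← Complex.ofReal_mul, div_mul_div_comm, Real.mul_self_sqrt (Nat.cast_nonneg _), one_mul]
    push_cast
    rfl
  simp only [transferFun, mulVec, dotProduct, map_sum, map_mul, weightedMatrix_apply,
    Complex.conj_ofReal, conj_expFun, Complex.conj_conj, hsqrt, Finset.mul_sum]
  rw [← Finset.sum_coe_sort B]
  refine Finset.sum_congr rfl fun b _ => ?_
  rw [expFun_tau, expFun_comm, mul_neg]
  ring

theorem sum_norm_sq_transferFun
    (hiso : (weightedMatrix R B l α).conjTranspose * weightedMatrix R B l α = 1)
    (v : ℝ → ℂ) (x : ℝ) :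
    ∑ i, ‖transferFun R B l α i v x‖ ^ 2 =
      (B.card : ℝ)⁻¹ * ∑ b ∈ B, ‖v (tau R b x)‖ ^ 2 := by
  have hsqrt : ‖((1 / Real.sqrt B.card : ℝ) : ℂ)‖ ^ 2 = (B.card : ℝ)⁻¹ := by
    rw [Complex.norm_real, Real.norm_eq_abs, sq_abs, div_pow, Real.sq_sqrt (Nat.cast_nonneg _),
      one_pow, one_div]
  simp only [transferFun_eq_mulVec, norm_mul, norm_expFun, one_mul, mul_pow, hsqrt,
    RCLike.norm_conj, ← Finset.mul_sum, sum_norm_sq_mulVec_of_isometry hiso]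
  rw [Finset.sum_coe_sort B fun b => ‖v (tau R b x)‖ ^ 2]

/-- The numbers `‖ν_i(t)‖²` are the transition probabilities of a random walk, which moves from
`t` to `g_i(t)` with probability `‖ν_i(t)‖²`. -/
def IsStochastic (R : ℤ) (B : Finset ℤ) {m : ℕ} (l : Fin m → ℤ) (α : Fin m → ℂ) : Prop :=
  ∀ t, ∑ i, ‖nu R B l α i t‖₊ ^ 2 = 1

theorem IsStochastic.sum_norm_sq (hν : IsStochastic R B l α) (t : ℝ) :
    ∑ i, ‖nu R B l α i t‖ ^ 2 = 1 := by
  simpa using congrArg ((↑) : ℝ≥0 → ℝ) (hν t)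

theorem isStochastic_of_isometry (hB : B.Nonempty)
    (hiso : (weightedMatrix R B l α).conjTranspose * weightedMatrix R B l α = 1) :
    IsStochastic R B l α := fun t => by
  have hN : (B.card : ℝ) ≠ 0 := by exact_mod_cast hB.card_ne_zero
  have h := sum_norm_sq_transferFun hiso (expFun t) 0
  simp only [transferFun_expFun, norm_mul, norm_expFun, mul_one, one_pow, Finset.sum_const,
    nsmul_eq_mul, inv_mul_cancel₀ hN] at h
  exact NNReal.eq (by simpa using h)

theorem memLp_transferFun (hμ : IsInvariantMeasure R B μ) (i : Fin m) {v : ℝ → ℂ} {p : ℝ≥0∞}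
    (hv : MemLp v p μ) : MemLp (transferFun R B l α i v) p μ := by
  have hsum : MemLp (fun x => ∑ b ∈ B, expFun (-(l i : ℝ)) (tau R b x) * v (tau R b x)) p μ :=
    memLp_finsetSum B fun b hb => hμ.memLp_comp_tau hb (memLp_expFun_mul (-(l i : ℝ)) hv)
  exact (hsum.const_mul _).const_mul _

/-- The transfer operator `v ↦ conj(α_i) N⁻¹ ∑_b (e_{-l_i} v) ∘ τ_b` on `L²(μ)`. -/
noncomputable def transfer (hμ : IsInvariantMeasure R B μ) (l : Fin m → ℤ) (α : Fin m → ℂ)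
    (i : Fin m) (v : Lp ℂ 2 μ) : Lp ℂ 2 μ :=
  (memLp_transferFun (l := l) (α := α) hμ i (Lp.memLp v)).toLp _

theorem coeFn_transfer (hμ : IsInvariantMeasure R B μ) (i : Fin m) (v : Lp ℂ 2 μ) :
    transfer hμ l α i v =ᵐ[μ] transferFun R B l α i v :=
  MemLp.coeFn_toLp _

theorem sum_norm_sq_transfer (hB : B.Nonempty) (hμ : IsInvariantMeasure R B μ)
    (hiso : (weightedMatrix R B l α).conjTranspose * weightedMatrix R B l α = 1)
    (v : Lp ℂ 2 μ) : ∑ i, ‖transfer hμ l α i v‖ ^ 2 = ‖v‖ ^ 2 := by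
  have hv : Integrable (fun x => ‖v x‖ ^ 2) μ := (Lp.memLp v).integrable_norm_pow two_ne_zero
  have hT : ∀ i, ‖transfer hμ l α i v‖ ^ 2 = ∫ x, ‖transferFun R B l α i v x‖ ^ 2 ∂μ :=
    fun i => by
      rw [norm_sq_eq_integral]
      exact integral_congr_ae ((coeFn_transfer hμ i v).fun_comp (‖·‖ ^ 2))
  simp only [hT]
  rw [← integral_finsetSum _ fun i _ =>
    (memLp_transferFun hμ i (Lp.memLp v)).integrable_norm_pow two_ne_zero]
  simp only [sum_norm_sq_transferFun hiso]
  rw [integral_const_mul, norm_sq_eq_integral, hμ.integral_eq_average hB hv, smul_eq_mul]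

theorem inner_expLp_transfer (hR : R ≠ 0) (hB : B.Nonempty) (hμ : IsInvariantMeasure R B μ)
    {c : ℝ} (hc : IsDual B c) (i : Fin m) (v : Lp ℂ 2 μ) :
    inner ℂ (expLp μ c) (transfer hμ l α i v) =
      conj (α i) * inner ℂ (expLp μ (l i + R * c)) v := by
  have hint : Integrable (fun x => expFun (-(l i + R * c)) x * v x) μ :=
    (memLp_expFun_mul _ (Lp.memLp v)).integrable (by norm_num)
  have hT : ∫ x, expFun (-c) x * transfer hμ l α i v x ∂μ =
      ∫ x, expFun (-c) x * transferFun R B l α i v x ∂μ :=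
    integral_congr_ae ((coeFn_transfer hμ i v).mono fun x hx => congrArg (expFun (-c) x * ·) hx)
  rw [inner_expLp, inner_expLp, hT, hμ.integral_eq_average hB hint]
  simp only [expFun_neg_mul_transferFun hR hc, integral_const_mul]
  rw [Complex.real_smul]
  push_cast
  rw [one_div]

theorem transfer_expLp (hμ : IsInvariantMeasure R B μ) (i : Fin m) (t : ℝ) :
    transfer hμ l α i (expLp μ t) = nu R B l α i t • expLp μ (g R l i t) := by
  have hτ : ∀ᵐ x ∂μ, ∀ b ∈ B, expLp μ t (tau R b x) = expFun t (tau R b x) :=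
    (eventually_all_finset B).2 fun b hb => (hμ.quasiMeasurePreserving_tau hb).ae (coeFn_expLp t)
  refine Lp.ext ?_
  filter_upwards [coeFn_transfer (l := l) (α := α) hμ i (expLp μ t), hτ,
    coeFn_expLp (ρ := μ) (g R l i t), Lp.coeFn_smul (nu R B l α i t) (expLp μ (g R l i t))]
    with x hT hτ hg hsmul
  rw [hT, hsmul, Pi.smul_apply, hg, smul_eq_mul, ← transferFun_expFun, transferFun, transferFun]
  exact congrArg _ (congrArg _ (Finset.sum_congr rfl fun b hb => by rw [hτ b hb]))

/-! ### Totality of the exponentials -/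

theorem charFun_withDensity_ofReal {ρ : Measure ℝ} {h : ℝ → ℝ} (hh : AEMeasurable h ρ) (t : ℝ) :
    charFun (ρ.withDensity fun x => ENNReal.ofReal (h x)) t =
      ∫ x, expFun (t / (2 * Real.pi)) x * ((max (h x) 0 : ℝ) : ℂ) ∂ρ := by
  have hexp : ∀ x : ℝ, Complex.exp (t * x * Complex.I) = expFun (t / (2 * Real.pi)) x := fun x => by
    have hπ : (Real.pi : ℂ) ≠ 0 := Complex.ofReal_ne_zero.2 Real.pi_ne_zero
    rw [expFun]
    congr 1
    push_cast
    field_simp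
  rw [charFun_apply_real, integral_withDensity_eq_integral_toReal_smul₀ hh.ennreal_ofReal (by simp)]
  refine integral_congr_ae (Eventually.of_forall fun x => ?_)
  simp only [hexp, ENNReal.toReal_ofReal', Complex.real_smul]
  rw [mul_comm]

theorem integrable_expFun_mul {ρ : Measure ℝ} {k : ℝ → ℂ} (hk : Integrable k ρ) (t : ℝ) :
    Integrable (fun x => expFun t x * k x) ρ :=
  memLp_one_iff_integrable.1 (memLp_expFun_mul t (memLp_one_iff_integrable.2 hk))

theorem ae_eq_zero_of_integral_expFun_mul_ofReal {ρ : Measure ℝ} {h : ℝ → ℝ} (hh : Integrable h ρ)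
    (h0 : ∀ t, ∫ x, expFun t x * (h x : ℂ) ∂ρ = 0) : h =ᵐ[ρ] 0 := by
  have hpos := hh.aestronglyMeasurable.aemeasurable
  have hneg : AEMeasurable (fun x => -h x) ρ := hpos.neg
  have hpos_part : Integrable (fun x => ((max (h x) 0 : ℝ) : ℂ)) ρ := hh.pos_part.ofReal
  have hneg_part : Integrable (fun x => ((max (-h x) 0 : ℝ) : ℂ)) ρ := hh.neg.pos_part.ofReal
  have : IsFiniteMeasure (ρ.withDensity fun x => ENNReal.ofReal (h x)) :=
    isFiniteMeasure_withDensity_ofReal hh.2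
  have : IsFiniteMeasure (ρ.withDensity fun x => ENNReal.ofReal (-h x)) :=
    isFiniteMeasure_withDensity_ofReal hh.neg.2
  have hdensity : (ρ.withDensity fun x => ENNReal.ofReal (h x)) =
      ρ.withDensity fun x => ENNReal.ofReal (-h x) := by
    refine Measure.ext_of_charFun (funext fun t => ?_)
    rw [charFun_withDensity_ofReal hpos, charFun_withDensity_ofReal hneg, ← sub_eq_zero,
      ← integral_sub (integrable_expFun_mul hpos_part _)
        (integrable_expFun_mul hneg_part _), ← h0 (t / (2 * Real.pi))]
    refine integral_congr_ae (Eventually.of_forall fun x => ?_)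
    simp only [← mul_sub, ← Complex.ofReal_sub, max_zero_sub_max_neg_zero_eq_self]
  rw [withDensity_eq_iff hpos.ennreal_ofReal hneg.ennreal_ofReal
    ((lintegral_ofReal_le_lintegral_enorm h).trans_lt hh.2).ne] at hdensity
  filter_upwards [hdensity] with x hx
  have hmax := congrArg ENNReal.toReal hx
  simp only [ENNReal.toReal_ofReal'] at hmax
  rw [Pi.zero_apply, ← max_zero_sub_max_neg_zero_eq_self (h x), hmax, sub_self]

theorem ae_eq_zero_of_integral_expFun_mul {ρ : Measure ℝ} {v : ℝ → ℂ} (hv : Integrable v ρ)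
    (h0 : ∀ t, ∫ x, expFun t x * v x ∂ρ = 0) : v =ᵐ[ρ] 0 := by
  have hconj : ∀ t, ∫ x, expFun t x * conj (v x) ∂ρ = 0 := fun t => by
    have h := congrArg conj (h0 (-t))
    rw [← integral_conj, map_zero] at h
    simpa only [map_mul, conj_expFun, neg_neg] using h
  have hvc : Integrable (fun x => conj (v x)) ρ :=
    (LinearIsometryEquiv.integrable_comp_iff Complex.conjLIE).2 hv
  have hre := ae_eq_zero_of_integral_expFun_mul_ofReal hv.re fun t => by
    have hx : ∀ x, expFun t x * ((RCLike.re (v x) : ℝ) : ℂ) =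
        (1 / 2) * (expFun t x * v x + expFun t x * conj (v x)) := fun x => by
      rw [RCLike.re_eq_complex_re, Complex.re_eq_add_conj]; ring
    simp only [hx]
    rw [integral_const_mul, integral_add (integrable_expFun_mul hv t)
      (integrable_expFun_mul hvc t), h0, hconj, add_zero, mul_zero]
  have him := ae_eq_zero_of_integral_expFun_mul_ofReal hv.im fun t => by
    have hx : ∀ x, expFun t x * ((RCLike.im (v x) : ℝ) : ℂ) =
        (1 / (2 * Complex.I)) * (expFun t x * v x - expFun t x * conj (v x)) := fun x => by
      rw [RCLike.im_eq_complex_im, Complex.im_eq_sub_conj]; ring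
    simp only [hx]
    rw [integral_const_mul, integral_sub (integrable_expFun_mul hv t)
      (integrable_expFun_mul hvc t), h0, hconj, sub_zero, mul_zero]
  filter_upwards [hre, him] with x hx hy
  exact Complex.ext hx hy

theorem topologicalClosure_span_range_expLp {ρ : Measure ℝ} [IsFiniteMeasure ρ] :
    (Submodule.span ℂ (Set.range (expLp ρ))).topologicalClosure = ⊤ := by
  rw [Submodule.topologicalClosure_eq_top_iff, Submodule.eq_bot_iff]
  intro v hv
  refine Lp.eq_zero_iff_ae_eq_zero.2 (ae_eq_zero_of_integral_expFun_mul
    ((Lp.memLp v).integrable one_le_two) fun t => ?_)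
  rw [← neg_neg t, ← inner_expLp]
  exact (Submodule.mem_orthogonal _ _).1 hv _ (Submodule.subset_span ⟨-t, rfl⟩)

/-! ### Compact support and analyticity -/

theorem exp_boundedContinuousFunction_apply {X : Type*} [TopologicalSpace X] (f : X →ᵇ ℂ) (x : X) :
    NormedSpace.exp f x = Complex.exp (f x) := by
  let ev : (X →ᵇ ℂ) →+* ℂ :=
    { toFun := fun f => f x, map_one' := rfl, map_mul' := fun _ _ => rfl, map_zero' := rfl,
      map_add' := fun _ _ => rfl }
  rw [Complex.exp_eq_exp_ℂ]
  exact NormedSpace.map_exp ev (continuous_eval_const x) f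

theorem contDiff_expLp {ρ : Measure ℝ} [IsFiniteMeasure ρ] {r : ℝ} (hr : ∀ᵐ x ∂ρ, |x| ≤ r) :
    ContDiff ℝ ⊤ (expLp ρ) := by
  have hI : -|r| ≤ |r| := neg_le_self (abs_nonneg r)
  -- `x ↦ 2πix`, truncated outside `[-|r|, |r|]`
  let ψ : ℝ →ᵇ ℂ := (mkOfCompact ⟨fun y : Set.Icc (-|r|) |r| => 2 * Real.pi * Complex.I * (y : ℝ),
    by fun_prop⟩).compContinuous ⟨Set.projIcc _ _ hI, continuous_projIcc⟩
  have hexp : expLp ρ = fun t : ℝ => toLp 2 ρ ℝ (NormedSpace.exp (t • ψ)) := by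
    ext1 t
    refine Lp.ext ?_
    filter_upwards [coeFn_expLp (ρ := ρ) t,
      coeFn_toLp (p := 2) ρ ℝ (NormedSpace.exp (t • ψ)), hr] with x hx hψ hxr
    have hproj : ((Set.projIcc _ _ hI x : Set.Icc (-|r|) |r|) : ℝ) = x := by
      rw [Set.projIcc_of_mem hI (abs_le.1 (hxr.trans (le_abs_self r)))]
    rw [hx, hψ, exp_boundedContinuousFunction_apply, expFun]
    congr 1
    simp only [ψ, coe_smul, compContinuous_apply, mkOfCompact_apply, ContinuousMap.coe_mk, hproj,
      Complex.real_smul]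
    ring
  have hcont : ContDiff ℝ ⊤ (NormedSpace.exp : (ℝ →ᵇ ℂ) → _) :=
    contDiff_omega_iff_analyticOnNhd.2 fun x _ => NormedSpace.exp_analytic (𝕂 := ℝ) x
  rw [hexp]
  exact (ContinuousLinearMap.contDiff _).comp (hcont.comp (contDiff_id.smul contDiff_const))

theorem abs_tau_le (hR : 1 < |R|) {b : ℤ} {C : ℝ} (hb : |(b : ℝ)| ≤ C) (x : ℝ) :
    |tau R b x| ≤ (|x| + C) / 2 := by
  have hR2 : (2 : ℝ) ≤ |(R : ℝ)| := by exact_mod_cast hR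
  rw [tau, abs_mul, abs_inv, inv_mul_eq_div]
  exact div_le_div₀ (by linarith [abs_nonneg x, abs_nonneg (b : ℝ)])
    ((abs_add_le x b).trans (by linarith)) two_pos hR2

-- The excess `(|x| - C)⁺` over a bound `C` for `B` is at least halved by every `τ_b`, so its
-- arctangent can only have an invariant integral if it vanishes almost everywhere.
theorem IsInvariantMeasure.ae_abs_le (hμ : IsInvariantMeasure R B μ) (hR : 1 < |R|)
    (hB : B.Nonempty) {C : ℝ} (hC : ∀ b ∈ B, |(b : ℝ)| ≤ C) : ∀ᵐ x ∂μ, |x| ≤ C := by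
  set y : ℝ → ℝ := fun x => max (|x| - C) 0
  have hy0 : ∀ x, 0 ≤ y x := fun x => le_max_right _ _
  have hint : ∀ k : ℝ, Integrable (fun x => Real.arctan (k * y x)) μ := fun k =>
    .of_bound (by fun_prop) (Real.pi / 2) (Eventually.of_forall fun x =>
      abs_le.2 ⟨(Real.neg_pi_div_two_lt_arctan _).le, (Real.arctan_lt_pi_div_two _).le⟩)
  have hτ : ∀ x, ∀ b ∈ B, Real.arctan (1 * y (tau R b x)) ≤ Real.arctan (1 / 2 * y x) :=
    fun x b hb => Real.arctan_mono <| by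
      have := abs_tau_le hR (hC b hb) x
      rw [one_mul]
      refine max_le ?_ (by linarith [hy0 x])
      linarith [le_max_left (|x| - C) 0]
  have hle : ∫ x, Real.arctan (1 * y x) ∂μ ≤ ∫ x, Real.arctan (1 / 2 * y x) ∂μ := by
    rw [hμ.integral_eq_average hB (hint 1), smul_eq_mul,
      inv_mul_le_iff₀ (Nat.cast_pos.2 hB.card_pos), ← integral_const_mul]
    refine integral_mono (integrable_finsetSum _ fun b hb => hμ.integrable_comp_tau hb (hint 1))
      ((hint _).const_mul _) fun x => ?_
    simpa using Finset.sum_le_sum (hτ x)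
  have hmono : ∀ x, Real.arctan (1 / 2 * y x) ≤ Real.arctan (1 * y x) := fun x =>
    Real.arctan_mono (by linarith [hy0 x])
  have heq := (integral_eq_iff_of_ae_le (hint _) (hint _) (Eventually.of_forall hmono)).1
    (le_antisymm (integral_mono (hint _) (hint _) hmono) hle)
  filter_upwards [heq] with x hx
  have := Real.arctan_injective hx
  linarith [le_max_left (|x| - C) 0]

/-! ### Words and frequencies -/

theorem add_mul_g (hR : R ≠ 0) (i : Fin m) (t : ℝ) : l i + R * g R l i t = t := by
  have hR' : (R : ℝ) ≠ 0 := by exact_mod_cast hR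
  rw [g, mul_inv_cancel_left₀ hR', add_sub_cancel]

theorem g_add_mul (hR : R ≠ 0) (i : Fin m) (t : ℝ) : g R l i (l i + R * t) = t := by
  have hR' : (R : ℝ) ≠ 0 := by exact_mod_cast hR
  rw [g, add_sub_cancel_left, inv_mul_cancel_left₀ hR']

theorem abs_g_le (hR : 1 < |R|) {i : Fin m} {L : ℝ} (hL : |(l i : ℝ)| ≤ L) (t : ℝ) :
    |g R l i t| ≤ (|t| + L) / 2 := by
  have hg : g R l i t = tau R (-l i) t := by rw [g, tau, Int.cast_neg, sub_eq_add_neg]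
  rw [hg]
  exact abs_tau_le hR (by rwa [Int.cast_neg, abs_neg]) t

theorem abs_g_sub_g_lt (hR : 1 < |R|) (i : Fin m) {s t : ℝ} (hst : s ≠ t) :
    |g R l i s - g R l i t| < |s - t| := by
  have hR' : 1 < |(R : ℝ)| := by exact_mod_cast hR
  rw [g, g, ← mul_sub, sub_sub_sub_cancel_right, abs_mul, abs_inv]
  exact mul_lt_of_lt_one_left (abs_pos.2 (sub_ne_zero.2 hst)) (inv_lt_one_of_one_lt₀ hR')

theorem wordFreq_nil (c : ℝ) : wordFreq R l [] c = c := by simp [wordFreq]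

theorem wordFreq_cons (i : Fin m) (ω : List (Fin m)) (c : ℝ) :
    wordFreq R l (i :: ω) c = l i + R * wordFreq R l ω c := by
  have hsum : ∑ k : Fin (i :: ω).length, (R : ℝ) ^ (k : ℕ) * l ((i :: ω).get k) =
      l i + R * ∑ k : Fin ω.length, (R : ℝ) ^ (k : ℕ) * l (ω.get k) := by
    refine (Fin.sum_univ_succ _).trans ?_
    simp [Finset.mul_sum, pow_succ', mul_assoc]
  rw [wordFreq, wordFreq, hsum, List.length_cons]
  ring

theorem wordFreq_gWord (hR : R ≠ 0) (ω : List (Fin m)) (t : ℝ) :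
    wordFreq R l ω (gWord R l ω t) = t := by
  induction ω generalizing t with
  | nil => exact wordFreq_nil t
  | cons i ω ih => rw [wordFreq_cons, gWord, ih, add_mul_g hR]

/-! ### Points dual to `B` -/

theorem isDual_intCast (k : ℤ) : IsDual B k := fun b _ => ⟨b * k, by push_cast; rfl⟩

theorem IsDual.add_mul {c : ℝ} (hc : IsDual B c) (a : ℤ) : IsDual B (a + R * c) := fun b hb => by
  obtain ⟨k, hk⟩ := hc b hb
  exact ⟨b * a + R * k, by push_cast; rw [← hk]; ring⟩

theorem IsDual.wordFreq {c : ℝ} (hc : IsDual B c) (ω : List (Fin m)) :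
    IsDual B (wordFreq R l ω c) := by
  induction ω with
  | nil => rwa [wordFreq_nil]
  | cons i ω ih => exact wordFreq_cons (R := R) i ω c ▸ ih.add_mul _

theorem IsDual.mB_add {c : ℝ} (hc : IsDual B c) (t : ℝ) : mB B (t + c) = mB B t := by
  rw [mB_eq_sum_expFun, mB_eq_sum_expFun]
  congr 1
  refine Finset.sum_congr rfl fun b hb => ?_
  rw [expFun_comm, expFun_add, expFun_comm c, isDual_iff_expFun.1 hc b hb, mul_one, expFun_comm]

theorem IsDual.mB_eq_one (hB : B.Nonempty) {c : ℝ} (hc : IsDual B c) : mB B c = 1 := by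
  have hN : (B.card : ℂ) ≠ 0 := by exact_mod_cast hB.card_ne_zero
  rw [mB_eq_sum_expFun, Finset.sum_congr rfl (isDual_iff_expFun.1 hc), Finset.sum_const,
    nsmul_eq_mul, mul_one, one_div, inv_mul_cancel₀ hN]

theorem mB_fract (t : ℝ) : mB B (Int.fract t) = mB B t := by
  rw [← (isDual_intCast ⌊t⌋).mB_add, Int.fract_add_floor]

theorem nu_of_isDual_g (hB : B.Nonempty) {i : Fin m} {t : ℝ} (h : IsDual B (g R l i t)) :
    nu R B l α i t = conj (α i) := by
  rw [nu, h.mB_eq_one hB, mul_one]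

theorem nuWord_wordFreq (hR : R ≠ 0) (hB : B.Nonempty) {c : ℝ} (hc : IsDual B c)
    (ω : List (Fin m)) : nuWord R B l α ω (wordFreq R l ω c) = conj (ω.map α).prod := by
  induction ω with
  | nil => rw [nuWord, List.map_nil, List.prod_nil, map_one]
  | cons i ω ih =>
    have hg : g R l i (wordFreq R l (i :: ω) c) = wordFreq R l ω c := by
      rw [wordFreq_cons, g_add_mul hR]
    rw [nuWord, nu_of_isDual_g hB (hg ▸ hc.wordFreq ω), hg, ih, List.map_cons, List.prod_cons,
      map_mul]

theorem norm_sum_expFun_le (B : Finset ℤ) (t : ℝ) : ‖∑ b ∈ B, expFun b t‖ ≤ B.card :=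
  (norm_sum_le_of_le B fun b _ => (norm_expFun b t).le).trans_eq (by simp)

theorem norm_mB (B : Finset ℤ) (t : ℝ) : ‖mB B t‖ = ‖∑ b ∈ B, expFun b t‖ / B.card := by
  rw [mB_eq_sum_expFun, norm_mul, norm_div, norm_one, Complex.norm_natCast, one_div_mul_eq_div]

theorem norm_mB_le_one (B : Finset ℤ) (t : ℝ) : ‖mB B t‖ ≤ 1 := by
  rw [norm_mB]
  exact div_le_one_of_le₀ (norm_sum_expFun_le B t) (Nat.cast_nonneg _)

theorem isDual_of_norm_mB_eq_one (hB : 0 ∈ B) {t : ℝ} (h : ‖mB B t‖ = 1) : IsDual B t := by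
  have hcard : (B.card : ℝ) = ‖∑ b ∈ B, expFun b t‖ := by
    rw [norm_mB] at h
    exact (eq_of_div_eq_one h).symm
  refine isDual_iff_expFun.2 fun b hb => ?_
  have hb0 : expFun b t = expFun (0 : ℤ) t :=
    eq_of_card_le_norm_sum (f := fun b : ℤ => expFun b t) (fun b _ => norm_expFun b t)
      hcard.le hb hB
  rw [hb0, expFun_eq_one_iff]
  exact ⟨0, by rw [Int.cast_zero, zero_mul]⟩

/-! ### Finite invariant sets -/

theorem fract_mul_fract_g (hR : R ≠ 0) (i : Fin m) (t : ℝ) :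
    Int.fract (R * Int.fract (g R l i t)) = Int.fract t := by
  refine Int.fract_eq_fract.2 ⟨-l i - R * ⌊g R l i t⌋, ?_⟩
  rw [Int.fract]
  push_cast
  linear_combination add_mul_g (l := l) hR i t

-- For `fract (g_i t) = y` the point `g_i(t - R y)` is an integer, so `ν_i(t - R y) = conj (α_i)`.
theorem sum_norm_sq_fract_fiber_le_one (hR : R ≠ 0) (hB : B.Nonempty) (hν : IsStochastic R B l α)
    (t y : ℝ) : ∑ i with Int.fract (g R l i t) = y, ‖α i‖ ^ 2 ≤ 1 := by
  have hR' : (R : ℝ) ≠ 0 := by exact_mod_cast hR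
  rw [← hν.sum_norm_sq (t - R * y)]
  calc ∑ i with Int.fract (g R l i t) = y, ‖α i‖ ^ 2
      = ∑ i with Int.fract (g R l i t) = y, ‖nu R B l α i (t - R * y)‖ ^ 2 := by
        refine Finset.sum_congr rfl fun i hi => ?_
        have hint : g R l i (t - R * y) = ⌊g R l i t⌋ := by
          rw [← (Finset.mem_filter.1 hi).2, ← Int.self_sub_fract, g, g]
          field_simp
          ring
        rw [nu_of_isDual_g hB (hint ▸ isDual_intCast _), RCLike.norm_conj]
    _ ≤ ∑ i, ‖nu R B l α i (t - R * y)‖ ^ 2 :=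
        Finset.sum_le_sum_of_subset_of_nonneg (Finset.filter_subset _ _) fun _ _ _ => sq_nonneg _

theorem one_le_sum_norm_mB_fract (hR : R ≠ 0) (hB : B.Nonempty) (hν : IsStochastic R B l α)
    {s : ℝ} {M : Finset ℝ} (hM : ∀ i, nu R B l α i s ≠ 0 → Int.fract (g R l i s) ∈ M) :
    1 ≤ ∑ y ∈ M with Int.fract ((R : ℝ) * y) = Int.fract s, ‖mB B y‖ ^ 2 := by
  set F := {y ∈ M | Int.fract ((R : ℝ) * y) = Int.fract s}
  have hν_le : ∀ i, ‖nu R B l α i s‖ ^ 2 ≤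
      ∑ y ∈ F, if Int.fract (g R l i s) = y then ‖α i‖ ^ 2 * ‖mB B y‖ ^ 2 else 0 := fun i => by
    rw [Finset.sum_ite_eq]
    split_ifs with hi
    · rw [mB_fract, nu, norm_mul, mul_pow, RCLike.norm_conj]
    · have hi0 : nu R B l α i s = 0 := by
        by_contra h0
        exact hi (Finset.mem_filter.2 ⟨hM i h0, fract_mul_fract_g hR i s⟩)
      rw [hi0, norm_zero, zero_pow two_ne_zero]
  calc 1 = ∑ i, ‖nu R B l α i s‖ ^ 2 := (hν.sum_norm_sq s).symm
    _ ≤ ∑ i, ∑ y ∈ F, if Int.fract (g R l i s) = y then ‖α i‖ ^ 2 * ‖mB B y‖ ^ 2 else 0 :=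
        Finset.sum_le_sum fun i _ => hν_le i
    _ = ∑ y ∈ F, (∑ i with Int.fract (g R l i s) = y, ‖α i‖ ^ 2) * ‖mB B y‖ ^ 2 := by
        rw [Finset.sum_comm]
        simp only [← Finset.sum_filter, Finset.sum_mul]
    _ ≤ ∑ y ∈ F, ‖mB B y‖ ^ 2 := Finset.sum_le_sum fun y _ =>
        mul_le_of_le_one_left (sq_nonneg _) (sum_norm_sq_fract_fiber_le_one hR hB hν s y)

theorem IsInvariantSet.isDual {S : Set ℝ} (hS : IsInvariantSet R B l α S) (hfin : S.Finite)
    (hR : R ≠ 0) (hB : 0 ∈ B) (hν : IsStochastic R B l α) {c : ℝ} (hc : c ∈ S) : IsDual B c := by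
  set M := hfin.toFinset.image Int.fract
  have hmem : ∀ x ∈ S, Int.fract x ∈ M := fun x hx =>
    Finset.mem_image_of_mem _ (hfin.mem_toFinset.2 hx)
  have hfiber : ∀ x ∈ M, 1 ≤ ∑ y ∈ M with Int.fract ((R : ℝ) * y) = x, ‖mB B y‖ ^ 2 :=
      fun x hx => by
    obtain ⟨s, hs, rfl⟩ := Finset.mem_image.1 hx
    exact one_le_sum_norm_mB_fract hR ⟨0, hB⟩ hν fun i hi =>
      hmem _ (hS s (hfin.mem_toFinset.1 hs) i hi)
  have h1 := eq_one_of_one_le_sum_fiber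
    (fun y _ => pow_le_one₀ (norm_nonneg _) (norm_mB_le_one B y)) hfiber _ (hmem c hc)
  rw [mB_fract] at h1
  exact isDual_of_norm_mB_eq_one hB ((pow_eq_one_iff_of_nonneg (norm_nonneg _) two_ne_zero).1 h1)

theorem IsStochastic.exists_nu_ne_zero (hν : IsStochastic R B l α) (t : ℝ) :
    ∃ i, nu R B l α i t ≠ 0 := by
  by_contra! h
  simpa [h] using hν t

theorem IsInvariantSet.union {S S' : Set ℝ} (hS : IsInvariantSet R B l α S)
    (hS' : IsInvariantSet R B l α S') : IsInvariantSet R B l α (S ∪ S') := fun t ht i hi =>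
  ht.imp (fun h => hS t h i hi) fun h => hS' t h i hi

theorem IsInvariantSet.inter {S S' : Set ℝ} (hS : IsInvariantSet R B l α S)
    (hS' : IsInvariantSet R B l α S') : IsInvariantSet R B l α (S ∩ S') := fun t ht i hi =>
  ⟨hS t ht.1 i hi, hS' t ht.2 i hi⟩

theorem IsInvariantSet.inner_expLp_eq_zero {S : Set ℝ} (hS : IsInvariantSet R B l α S)
    (hfin : S.Finite) (hR : 1 < |R|) (hB : 0 ∈ B) (hμ : IsInvariantMeasure R B μ)
    (hν : IsStochastic R B l α) : S.Pairwise fun x y => inner ℂ (expLp μ x) (expLp μ y) = 0 := by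
  have hR0 : R ≠ 0 := by rintro rfl; simp at hR
  intro x hx y hy hxy
  by_contra hne
  have hP : {p ∈ S ×ˢ S | p.1 ≠ p.2 ∧ inner ℂ (expLp μ p.1) (expLp μ p.2) ≠ 0}.Finite :=
    (hfin.prod hfin).subset fun p hp => hp.1
  -- A closest non-orthogonal pair is mapped by some `g_i` to an even closer one.
  obtain ⟨⟨a, b⟩, ⟨⟨ha, hb⟩, hab, hinner⟩, hmin⟩ :=
    hP.exists_minimalFor (fun p => |p.1 - p.2|) _ ⟨(x, y), ⟨hx, hy⟩, hxy, hne⟩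
  obtain ⟨i, hi⟩ := hν.exists_nu_ne_zero a
  have hga := hS a ha i hi
  have hdual := hS.isDual hfin hR0 hB hν hga
  have hshift := inner_expLp_transfer (l := l) (α := α) hR0 ⟨0, hB⟩ hμ hdual i (expLp μ b)
  rw [transfer_expLp, inner_smul_right, add_mul_g hR0, ← nu_of_isDual_g ⟨0, hB⟩ hdual] at hshift
  have hprod := hshift ▸ mul_ne_zero hi hinner
  have hgb := hS b hb i (left_ne_zero_of_mul hprod)
  have hgab : g R l i a ≠ g R l i b := fun h =>
    hab (by rw [← add_mul_g (l := l) hR0 i a, h, add_mul_g hR0])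
  have hlt := abs_g_sub_g_lt (l := l) hR i hab
  exact hlt.not_ge (hmin (j := (g R l i a, g R l i b))
    ⟨⟨hga, hgb⟩, hgab, right_ne_zero_of_mul hprod⟩ hlt.le)

/-! ### Minimal finite invariant sets -/

theorem IsInvariantSet.exists_minimal_subset {Z : Set ℝ} (hZ : IsInvariantSet R B l α Z)
    (hfin : Z.Finite) (hne : Z.Nonempty) : ∃ S ⊆ Z, IsMinimalFiniteInvariantSet R B l α S := by
  have hF : {T : Set ℝ | T ⊆ Z ∧ T.Nonempty ∧ IsInvariantSet R B l α T}.Finite :=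
    hfin.finite_subsets.subset fun T hT => hT.1
  obtain ⟨S, hS⟩ := hF.exists_minimal ⟨Z, subset_rfl, hne, hZ⟩
  exact ⟨S, hS.prop.1, hfin.subset hS.prop.1, hS.prop.2, fun T hT hTS =>
    hS.le_of_le ⟨hTS.trans hS.prop.1, hT⟩ hTS⟩

namespace IsMinimalFiniteInvariantSet

variable {S S' : Set ℝ}

theorem finite (hS : IsMinimalFiniteInvariantSet R B l α S) : S.Finite := hS.1

theorem nonempty (hS : IsMinimalFiniteInvariantSet R B l α S) : S.Nonempty := hS.2.prop.1

theorem isInvariantSet (hS : IsMinimalFiniteInvariantSet R B l α S) : IsInvariantSet R B l α S :=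
  hS.2.prop.2

theorem subset_of_invariant (hS : IsMinimalFiniteInvariantSet R B l α S) {T : Set ℝ} (hTS : T ⊆ S)
    (hne : T.Nonempty) (hT : IsInvariantSet R B l α T) : S ⊆ T :=
  hS.2.le_of_le ⟨hne, hT⟩ hTS

theorem isDual (hS : IsMinimalFiniteInvariantSet R B l α S) (hR : R ≠ 0) (hB : 0 ∈ B)
    (hν : IsStochastic R B l α) {c : ℝ} (hc : c ∈ S) : IsDual B c :=
  hS.isInvariantSet.isDual hS.finite hR hB hν hc

theorem eq_of_mem (hS : IsMinimalFiniteInvariantSet R B l α S)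
    (hS' : IsMinimalFiniteInvariantSet R B l α S') {x : ℝ} (hx : x ∈ S) (hx' : x ∈ S') :
    S = S' := by
  have hinter := hS.isInvariantSet.inter hS'.isInvariantSet
  exact ((Set.subset_inter_iff.1
      (hS.subset_of_invariant Set.inter_subset_left ⟨x, hx, hx'⟩ hinter)).2).antisymm
    (Set.subset_inter_iff.1 (hS'.subset_of_invariant Set.inter_subset_right ⟨x, hx, hx'⟩ hinter)).1

theorem exists_predecessor (hS : IsMinimalFiniteInvariantSet R B l α S)
    (hν : IsStochastic R B l α) {c : ℝ} (hc : c ∈ S) :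
    ∃ x ∈ S, ∃ i, nu R B l α i x ≠ 0 ∧ g R l i x = c := by
  refine hS.subset_of_invariant (T := {c | ∃ x ∈ S, ∃ i, nu R B l α i x ≠ 0 ∧ g R l i x = c})
    ?_ ?_ ?_ hc
  · rintro _ ⟨x, hx, i, hi, rfl⟩
    exact hS.isInvariantSet x hx i hi
  · obtain ⟨x, hx⟩ := hS.nonempty
    obtain ⟨i, hi⟩ := hν.exists_nu_ne_zero x
    exact ⟨_, x, hx, i, hi, rfl⟩
  · rintro _ ⟨x, hx, i, hi, rfl⟩ j hj
    exact ⟨_, hS.isInvariantSet x hx i hi, j, hj, rfl⟩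

theorem abs_le (hS : IsMinimalFiniteInvariantSet R B l α S) (hR : 1 < |R|)
    (hν : IsStochastic R B l α) {L : ℝ} (hL : ∀ i, |(l i : ℝ)| ≤ L) {c : ℝ} (hc : c ∈ S) :
    |c| ≤ L := by
  obtain ⟨y, hy, hmax⟩ := Set.exists_max_image S (|·|) hS.finite hS.nonempty
  obtain ⟨x, hx, i, -, rfl⟩ := hS.exists_predecessor hν hy
  linarith [hmax c hc, hmax x hx, abs_g_le hR (hL i) x]

end IsMinimalFiniteInvariantSet

theorem finite_setOf_isMinimalFiniteInvariantSet (hR : 1 < |R|) (hB : 0 ∈ B)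
    (hμ : IsInvariantMeasure R B μ) (hν : IsStochastic R B l α) :
    {S : Set ℝ | IsMinimalFiniteInvariantSet R B l α S}.Finite := by
  obtain ⟨C, hC⟩ := Finite.exists_le fun b : B => |((b : ℤ) : ℝ)|
  obtain ⟨L, hL⟩ := Finite.exists_le fun i => |(l i : ℝ)|
  have hcont : Continuous (expLp μ) :=
    (contDiff_expLp (hμ.ae_abs_le hR ⟨0, hB⟩ fun b hb => hC ⟨b, hb⟩)).continuous
  have hunion : (⋃₀ {S : Set ℝ | IsMinimalFiniteInvariantSet R B l α S}).Finite := by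
    refine finite_of_pairwise_inner_eq_zero (𝕜 := ℂ) hcont
      (fun x => norm_ne_zero_iff.1 (norm_expLp (μ := μ) x ▸ one_ne_zero)) (isCompact_Icc (a := -L)
      (b := L)) (Set.sUnion_subset fun S hS x hx => abs_le.1 (hS.abs_le hR hν hL hx)) ?_
    rintro x ⟨S, hS, hx⟩ y ⟨S', hS', hy⟩
    exact (hS.isInvariantSet.union hS'.isInvariantSet).inner_expLp_eq_zero
      (hS.finite.union hS'.finite)
      hR hB hμ hν (.inl hx) (.inr hy)
  exact hunion.finite_subsets.subset fun S hS => Set.subset_sUnion_of_mem hS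

theorem isMinimal_singleton_zero [NeZero m] (hB : B.Nonempty) (hl : l 0 = 0) (hα : α 0 = 1)
    (hν : IsStochastic R B l α) : IsMinimalFiniteInvariantSet R B l α {0} := by
  have hg : g R l 0 0 = 0 := by rw [g, hl, Int.cast_zero, sub_zero, mul_zero]
  have h0 : nu R B l α 0 0 = 1 := by
    rw [nu_of_isDual_g hB (by simpa [hg] using isDual_intCast (B := B) 0), hα, map_one]
  have hrest : ∀ i ≠ 0, nu R B l α i 0 = 0 := fun i hi => by
    have h1 := hν 0
    rw [← Finset.add_sum_erase _ _ (Finset.mem_univ (0 : Fin m)), h0, nnnorm_one, one_pow,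
      add_eq_left, Finset.sum_eq_zero_iff] at h1
    simpa using h1 i (Finset.mem_erase.2 ⟨hi, Finset.mem_univ i⟩)
  refine ⟨Set.finite_singleton 0, ⟨Set.singleton_nonempty 0, ?_⟩, fun T hT hT0 => ?_⟩
  · rintro _ rfl i hi
    rw [not_imp_comm.1 (hrest i) hi]
    exact hg
  · exact ((Set.Nonempty.subset_singleton_iff hT.1).1 hT0).ge

/-! ### Recurrence on a minimal finite invariant set -/

/-- The probability that the walk started at `x` is not at `c` at the times `1, …, n`. -/
noncomputable def avoid (R : ℤ) (B : Finset ℤ) {m : ℕ} (l : Fin m → ℤ) (α : Fin m → ℂ) (c : ℝ) :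
    ℕ → ℝ → ℝ≥0
  | 0, _ => 1
  | n + 1, x => ∑ i, ‖nu R B l α i x‖₊ ^ 2 *
      if g R l i x = c then 0 else avoid R B l α c n (g R l i x)

theorem IsStochastic.antitone_avoid (hν : IsStochastic R B l α) (c x : ℝ) :
    Antitone fun n => avoid R B l α c n x := by
  refine antitone_nat_of_succ_le fun n => ?_
  induction n generalizing x with
  | zero =>
    refine (Finset.sum_le_sum fun i _ => mul_le_of_le_one_right' ?_).trans_eq (hν x)
    split_ifs
    exacts [zero_le_one, le_rfl]
  | succ n ih =>
    refine Finset.sum_le_sum fun i _ => ?_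
    gcongr
    split_ifs
    exacts [le_rfl, ih _]

-- By the maximum principle the maximum of `u` propagates along the walk, which reaches `c`.
theorem IsMinimalFiniteInvariantSet.eq_zero_of_absorbed_harmonic {S : Set ℝ}
    (hS : IsMinimalFiniteInvariantSet R B l α S) (hν : IsStochastic R B l α) {c : ℝ} (hc : c ∈ S)
    {u : ℝ → ℝ≥0} (hu : ∀ x ∈ S, ∑ i, ‖nu R B l α i x‖₊ ^ 2 *
      (if g R l i x = c then 0 else u (g R l i x)) = u x) {x : ℝ} (hx : x ∈ S) : u x = 0 := by
  obtain ⟨y, hy, hmax⟩ := Set.exists_max_image S u hS.finite hS.nonempty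
  have hstep : ∀ z ∈ S, u z = u y → ∀ i, nu R B l α i z ≠ 0 →
      (if g R l i z = c then 0 else u (g R l i z)) = u y := fun z hz hzy i hi => by
    refine eq_of_sum_mul_eq (fun _ => zero_le) (hν z) (fun j hj => ?_) ((hu z hz).trans hzy)
      (pow_ne_zero 2 (nnnorm_ne_zero_iff.2 hi))
    split_ifs
    · exact zero_le
    · exact hmax _ (hS.isInvariantSet z hz j (by simpa using hj))
  by_contra hux
  have hy0 : u y ≠ 0 := (pos_iff_ne_zero.2 hux).trans_le (hmax x hx) |>.ne'
  have hS_sub : S ⊆ {z ∈ S | u z = u y} := by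
    refine hS.subset_of_invariant (Set.sep_subset _ _) ⟨y, hy, rfl⟩ fun z hz i hi => ?_
    have h := hstep z hz.1 hz.2 i hi
    split_ifs at h
    exacts [absurd h.symm hy0, ⟨hS.isInvariantSet z hz.1 i hi, h⟩]
  obtain ⟨z, hz, i, hi, hzc⟩ := hS.exists_predecessor hν hc
  have h := hstep z hz (hS_sub hz).2 i hi
  rw [if_pos hzc] at h
  exact hy0 h.symm

theorem IsMinimalFiniteInvariantSet.tendsto_avoid {S : Set ℝ}
    (hS : IsMinimalFiniteInvariantSet R B l α S) (hν : IsStochastic R B l α) {c x : ℝ}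
    (hc : c ∈ S) (hx : x ∈ S) : Tendsto (fun n => avoid R B l α c n x) atTop (𝓝 0) := by
  set u : ℝ → ℝ≥0 := fun y => ⨅ n, avoid R B l α c n y
  have hlim : ∀ y, Tendsto (fun n => avoid R B l α c n y) atTop (𝓝 (u y)) := fun y =>
    tendsto_atTop_ciInf (hν.antitone_avoid c y) (OrderBot.bddBelow _)
  have hu : ∀ y, ∑ i, ‖nu R B l α i y‖₊ ^ 2 * (if g R l i y = c then 0 else u (g R l i y)) =
      u y := fun y => by
    refine tendsto_nhds_unique (tendsto_finsetSum _ fun i _ => Tendsto.const_mul _ ?_)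
      ((hlim y).comp (tendsto_add_atTop_nat 1))
    split_ifs
    exacts [tendsto_const_nhds, hlim _]
  exact hS.eq_zero_of_absorbed_harmonic hν hc (fun y _ => hu y) hx ▸ hlim x

/-! ### First passages -/

/-- The path that starts at `x` and follows the nonempty word `β` is at `c` at its end, and at no
intermediate time. -/
def IsFirstPassage (R : ℤ) {m : ℕ} (l : Fin m → ℤ) (c x : ℝ) (β : List (Fin m)) : Prop :=
  β ≠ [] ∧ gWord R l β x = c ∧ ∀ k, 0 < k → k < β.length → gWord R l (β.take k) x ≠ c

theorem isCycleWord_iff {c : ℝ} {β : List (Fin m)} :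
    IsCycleWord R B l α c β ↔ IsFirstPassage R l c c β ∧ nuWord R B l α β c ≠ 0 := by
  unfold IsCycleWord IsFirstPassage
  tauto

theorem isFirstPassage_cons_of_eq {c x : ℝ} {i : Fin m} {ω : List (Fin m)} (h : g R l i x = c) :
    IsFirstPassage R l c x (i :: ω) ↔ ω = [] := by
  refine ⟨fun ⟨_, _, hpath⟩ => ?_, ?_⟩
  · by_contra hω
    exact hpath 1 one_pos (by simpa using List.length_pos_iff.2 hω) (by simpa [gWord] using h)
  · rintro rfl
    refine ⟨List.cons_ne_nil _ _, h, fun k hk hk' => ?_⟩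
    rw [List.length_singleton] at hk'
    omega

theorem isFirstPassage_cons_of_ne {c x : ℝ} {i : Fin m} {ω : List (Fin m)} (h : g R l i x ≠ c) :
    IsFirstPassage R l c x (i :: ω) ↔ IsFirstPassage R l c (g R l i x) ω := by
  constructor
  · rintro ⟨-, hend, hpath⟩
    refine ⟨?_, hend, fun k _ hk => ?_⟩
    · rintro rfl
      exact h hend
    · simpa [gWord] using hpath (k + 1) k.succ_pos (by simpa using hk)
  · rintro ⟨-, hend, hpath⟩
    refine ⟨List.cons_ne_nil _ _, hend, fun k hk hk' => ?_⟩
    match k with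
    | 1 => simpa [gWord] using h
    | k + 2 => simpa [gWord] using hpath (k + 1) k.succ_pos (Nat.lt_of_succ_lt_succ hk')

/-- The probability that the walk started at `x` is at `c` at one of the times `1, …, n`. -/
noncomputable def hitProb (R : ℤ) (B : Finset ℤ) {m : ℕ} (l : Fin m → ℤ) (α : Fin m → ℂ) (c : ℝ)
    (n : ℕ) (x : ℝ) : ℝ≥0∞ :=
  ∑' β : {β | IsFirstPassage R l c x β},
    if β.1.length ≤ n then ‖nuWord R B l α β x‖ₑ ^ 2 else 0

theorem hitProb_zero (c x : ℝ) : hitProb R B l α c 0 x = 0 :=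
  ENNReal.tsum_eq_zero.2 fun β =>
    if_neg fun h => β.2.1 (List.length_eq_zero_iff.1 (Nat.le_zero.1 h))

theorem hitProb_succ (c : ℝ) (n : ℕ) (x : ℝ) :
    hitProb R B l α c (n + 1) x = ∑ i, ‖nu R B l α i x‖ₑ ^ 2 *
      if g R l i x = c then 1 else hitProb R B l α c n (g R l i x) := by
  rw [hitProb, tsum_subtype {β | IsFirstPassage R l c x β} fun β : List (Fin m) =>
      if β.length ≤ n + 1 then ‖nuWord R B l α β x‖ₑ ^ 2 else 0,
    tsum_list_eq_nil_add_sum_cons, Set.indicator_of_notMem fun h => h.1 rfl, zero_add]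
  refine Finset.sum_congr rfl fun i _ => ?_
  split_ifs with hi
  · have hmem : ∀ ω, i :: ω ∈ {β | IsFirstPassage R l c x β} ↔ ω = [] := fun _ =>
      isFirstPassage_cons_of_eq hi
    rw [tsum_eq_single [] fun ω hω => Set.indicator_of_notMem (mt (hmem ω).1 hω) _,
      Set.indicator_of_mem ((hmem []).2 rfl)]
    simp [nuWord]
  · have hmem : ∀ ω, i :: ω ∈ {β | IsFirstPassage R l c x β} ↔
        ω ∈ {β | IsFirstPassage R l c (g R l i x) β} := fun _ => isFirstPassage_cons_of_ne hi
    rw [hitProb, tsum_subtype {β | IsFirstPassage R l c (g R l i x) β} fun β : List (Fin m) =>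
      if β.length ≤ n then ‖nuWord R B l α β (g R l i x)‖ₑ ^ 2 else 0, ← ENNReal.tsum_mul_left]
    refine tsum_congr fun ω => ?_
    by_cases hω : ω ∈ {β | IsFirstPassage R l c (g R l i x) β}
    · rw [Set.indicator_of_mem ((hmem ω).2 hω), Set.indicator_of_mem hω]
      simp only [List.length_cons, Nat.add_le_add_iff_right, nuWord, enorm_mul, mul_pow, mul_ite,
        mul_zero]
    · rw [Set.indicator_of_notMem (mt (hmem ω).1 hω), Set.indicator_of_notMem hω, mul_zero]

theorem hitProb_add_avoid (hν : IsStochastic R B l α) (c : ℝ) (n : ℕ) (x : ℝ) :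
    hitProb R B l α c n x + avoid R B l α c n x = 1 := by
  induction n generalizing x with
  | zero => rw [hitProb_zero, avoid, zero_add, ENNReal.coe_one]
  | succ n ih =>
    have hone : ∑ i, ‖nu R B l α i x‖ₑ ^ 2 = 1 := by
      simp only [enorm_eq_nnnorm]
      exact_mod_cast congrArg ((↑) : ℝ≥0 → ℝ≥0∞) (hν x)
    rw [hitProb_succ, avoid, ENNReal.ofNNReal_finsetSum, ← Finset.sum_add_distrib]
    refine (Finset.sum_congr rfl fun i _ => ?_).trans hone
    rw [ENNReal.coe_mul, ENNReal.coe_pow, ← enorm_eq_nnnorm, ← mul_add]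
    split_ifs
    · rw [ENNReal.coe_zero, add_zero, mul_one]
    · rw [ih, mul_one]

/-! ### Words that do not end in a cycle word -/

theorem nil_mem_Omega0 (c : ℝ) : [] ∈ Omega0 R B l α c := fun ⟨_, hβ, hsuffix⟩ =>
  hβ.1 (List.suffix_nil.1 hsuffix)

theorem cons_mem_Omega0_iff {c : ℝ} {i : Fin m} {ω : List (Fin m)} :
    i :: ω ∈ Omega0 R B l α c ↔ ω ∈ Omega0 R B l α c ∧ ¬ IsCycleWord R B l α c (i :: ω) := by
  simp only [Omega0, Set.mem_ofPred_eq, ← not_or, not_iff_not, List.suffix_cons_iff]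
  constructor
  · rintro ⟨β, hβ, rfl | hsuffix⟩
    exacts [.inr hβ, .inl ⟨β, hβ, hsuffix⟩]
  · rintro (⟨β, hβ, hsuffix⟩ | hβ)
    exacts [⟨β, hβ, .inr hsuffix⟩, ⟨_, hβ, .inl rfl⟩]

theorem gWord_append (ω ω' : List (Fin m)) (t : ℝ) :
    gWord R l (ω ++ ω') t = gWord R l ω' (gWord R l ω t) := by
  induction ω generalizing t with
  | nil => rfl
  | cons i _ ih => exact ih _

theorem gWord_injective (hR : R ≠ 0) (ω : List (Fin m)) : Function.Injective (gWord R l ω) :=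
  Function.LeftInverse.injective (wordFreq_gWord hR ω)

theorem IsCycleWord.tail_mem_Omega0 (hR : R ≠ 0) {c : ℝ} {i : Fin m} {ω : List (Fin m)}
    (h : IsCycleWord R B l α c (i :: ω)) : ω ∈ Omega0 R B l α c := by
  rintro ⟨β, hβ, γ, rfl⟩
  obtain ⟨-, hend, hpath, -⟩ := h
  rw [← List.cons_append] at hend hpath
  have hreturn : gWord R l (i :: γ) c = c :=
    gWord_injective hR β (by rw [← gWord_append, hend, hβ.2.1])
  have hβ_pos := List.length_pos_iff.2 hβ.1
  refine hpath (i :: γ).length (by simp) (by rw [List.length_append]; omega) ?_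
  rwa [List.take_left]

-- Prepending a letter to a word of `Ω_c^{(0)}` gives each nonempty word of `Ω_c^{(0)}` and each
-- cycle word exactly once.
theorem nil_add_sum_tsum_cons_Omega0 (hR : R ≠ 0) (c : ℝ) (q : List (Fin m) → ℝ≥0∞) :
    q [] + ∑ i, ∑' ω : Omega0 R B l α c, q (i :: ω) =
      ∑' ω : Omega0 R B l α c, q ω + ∑' β : {β | IsCycleWord R B l α c β}, q β := by
  have hcons : ∀ i ω, (Omega0 R B l α c).indicator (fun ω => q (i :: ω)) ω =
      (Omega0 R B l α c).indicator q (i :: ω) +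
        {β | IsCycleWord R B l α c β}.indicator q (i :: ω) := fun i ω => by
    by_cases hβ : IsCycleWord R B l α c (i :: ω)
    · simp [Set.indicator, cons_mem_Omega0_iff, hβ, hβ.tail_mem_Omega0 hR]
    · have hmem : i :: ω ∈ Omega0 R B l α c ↔ ω ∈ Omega0 R B l α c :=
        cons_mem_Omega0_iff.trans (and_iff_left hβ)
      by_cases hω : ω ∈ Omega0 R B l α c <;> simp [Set.indicator, hmem, hω, hβ]
  have hnil : [] ∉ {β | IsCycleWord R B l α c β} := fun h => h.1 rfl
  simp only [tsum_subtype (Omega0 R B l α c), tsum_subtype {β | IsCycleWord R B l α c β},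
    fun i => tsum_subtype (Omega0 R B l α c) fun ω => q (i :: ω), hcons, ENNReal.tsum_add]
  rw [tsum_list_eq_nil_add_sum_cons ((Omega0 R B l α c).indicator q),
    tsum_list_eq_nil_add_sum_cons ({β | IsCycleWord R B l α c β}.indicator q),
    Set.indicator_of_mem (nil_mem_Omega0 c), Set.indicator_of_notMem hnil, zero_add,
    Finset.sum_add_distrib, add_assoc]

/-! ### The Bessel inequality -/

theorem weightedExp_nil (c : ℝ) : weightedExp μ R l α [] c = expLp μ c := by
  rw [weightedExp, List.map_nil, List.prod_nil, one_smul, wordFreq_nil]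

theorem inner_weightedExp_transfer (hR : R ≠ 0) (hB : B.Nonempty) (hμ : IsInvariantMeasure R B μ)
    {c : ℝ} (hc : IsDual B c) (i : Fin m) (ω : List (Fin m)) (v : Lp ℂ 2 μ) :
    inner ℂ (weightedExp μ R l α ω c) (transfer hμ l α i v) =
      inner ℂ (weightedExp μ R l α (i :: ω) c) v := by
  rw [weightedExp, weightedExp, inner_smul_left, inner_smul_left,
    inner_expLp_transfer hR hB hμ (hc.wordFreq ω), wordFreq_cons, List.map_cons, List.prod_cons,
    map_mul]
  ring

theorem enorm_inner_weightedExp_of_gWord_eq (hR : R ≠ 0) (hB : B.Nonempty) {c : ℝ}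
    (hc : IsDual B c) {β : List (Fin m)} (hβ : gWord R l β c = c) (v : Lp ℂ 2 μ) :
    ‖inner ℂ (weightedExp μ R l α β c) v‖ₑ =
      ‖nuWord R B l α β c‖ₑ * ‖inner ℂ (expLp μ c) v‖ₑ := by
  have hfreq : wordFreq R l β c = c := by
    conv_lhs => rw [← hβ]
    exact wordFreq_gWord hR β c
  have hν := nuWord_wordFreq (l := l) (α := α) hR hB hc β
  rw [hfreq] at hν
  rw [weightedExp, hfreq, inner_smul_left, enorm_mul, hν]

theorem enorm_nu_mul_inner_expLp (hR : R ≠ 0) (hB : B.Nonempty) (hμ : IsInvariantMeasure R B μ)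
    {i : Fin m} {t : ℝ} (ht : IsDual B (g R l i t)) (v : Lp ℂ 2 μ) :
    ‖nu R B l α i t‖ₑ * ‖inner ℂ (expLp μ t) v‖ₑ =
      ‖inner ℂ (expLp μ (g R l i t)) (transfer hμ l α i v)‖ₑ := by
  rw [inner_expLp_transfer hR hB hμ ht, add_mul_g hR, nu_of_isDual_g hB ht, enorm_mul]

theorem sum_enorm_sq_transfer (hB : B.Nonempty) (hμ : IsInvariantMeasure R B μ)
    (hiso : (weightedMatrix R B l α).conjTranspose * weightedMatrix R B l α = 1)
    (v : Lp ℂ 2 μ) : ∑ i, ‖transfer hμ l α i v‖ₑ ^ 2 = ‖v‖ₑ ^ 2 :=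
  sum_enorm_sq_eq_iff.2 (sum_norm_sq_transfer hB hμ hiso v)

/-- The sum of the squared moduli of the frame coefficients of `v` over the words of length at most
`n` in `Ω_c^{(0)}`. -/
noncomputable def frameSum (R : ℤ) (B : Finset ℤ) {m : ℕ} (l : Fin m → ℤ) (α : Fin m → ℂ) (c : ℝ)
    (n : ℕ) (v : Lp ℂ 2 μ) : ℝ≥0∞ :=
  ∑' ω : Omega0 R B l α c,
    if ω.1.length ≤ n then ‖inner ℂ (weightedExp μ R l α ω.1 c) v‖ₑ ^ 2 else 0

theorem frameSum_zero (c : ℝ) (v : Lp ℂ 2 μ) :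
    frameSum R B l α c 0 v = ‖inner ℂ (expLp μ c) v‖ₑ ^ 2 := by
  rw [frameSum, tsum_eq_single ⟨[], nil_mem_Omega0 c⟩ fun ω hω => ?_]
  · simp [weightedExp_nil]
  · exact if_neg fun h => hω (Subtype.ext (List.length_eq_zero_iff.1 (Nat.le_zero.1 h)))

theorem tendsto_frameSum (c : ℝ) (v : Lp ℂ 2 μ) :
    Tendsto (fun n => frameSum R B l α c n v) atTop
      (𝓝 (∑' ω : Omega0 R B l α c, ‖inner ℂ (weightedExp μ R l α ω.1 c) v‖ₑ ^ 2)) :=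
  tendsto_tsum_ite_le _ fun ω : Omega0 R B l α c => ω.1.length

theorem tsum_isCycleWord_eq_hitProb_mul (hR : R ≠ 0) (hB : B.Nonempty) {c : ℝ} (hc : IsDual B c)
    (n : ℕ) (v : Lp ℂ 2 μ) :
    ∑' β : {β | IsCycleWord R B l α c β},
        (if β.1.length ≤ n then ‖inner ℂ (weightedExp μ R l α β.1 c) v‖ₑ ^ 2 else 0) =
      hitProb R B l α c n c * ‖inner ℂ (expLp μ c) v‖ₑ ^ 2 := by
  set P := {β | IsFirstPassage R l c c β}
  set C := {β | IsCycleWord R B l α c β}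
  have hC : ∀ β, β ∈ C ↔ β ∈ P ∧ nuWord R B l α β c ≠ 0 := fun _ => isCycleWord_iff
  rw [hitProb, ← ENNReal.tsum_mul_right,
    tsum_subtype C fun β : List (Fin m) =>
      if β.length ≤ n then ‖inner ℂ (weightedExp μ R l α β c) v‖ₑ ^ 2 else 0,
    tsum_subtype P fun β : List (Fin m) =>
      (if β.length ≤ n then ‖nuWord R B l α β c‖ₑ ^ 2 else 0) * ‖inner ℂ (expLp μ c) v‖ₑ ^ 2]
  refine tsum_congr fun β => ?_
  by_cases hP : β ∈ P
  · by_cases hν : nuWord R B l α β c = 0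
    · rw [Set.indicator_of_notMem fun h => ((hC β).1 h).2 hν, Set.indicator_of_mem hP, hν]
      simp
    · rw [Set.indicator_of_mem ((hC β).2 ⟨hP, hν⟩), Set.indicator_of_mem hP,
        enorm_inner_weightedExp_of_gWord_eq hR hB hc hP.2.1, mul_pow, ite_mul, zero_mul]
  · rw [Set.indicator_of_notMem fun h => hP ((hC β).1 h).1, Set.indicator_of_notMem hP]

theorem frameSum_succ (hR : R ≠ 0) (hB : B.Nonempty) (hμ : IsInvariantMeasure R B μ)
    (hν : IsStochastic R B l α) {c : ℝ} (hc : IsDual B c) (n : ℕ) (v : Lp ℂ 2 μ) :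
    frameSum R B l α c (n + 1) v = ∑ i, frameSum R B l α c n (transfer hμ l α i v) +
      avoid R B l α c (n + 1) c * ‖inner ℂ (expLp μ c) v‖ₑ ^ 2 := by
  set E := ‖inner ℂ (expLp μ c) v‖ₑ ^ 2
  have hreturn := hitProb_add_avoid hν c (n + 1) c
  have hcount := nil_add_sum_tsum_cons_Omega0 (B := B) (l := l) (α := α) hR c fun ω =>
    if ω.length ≤ n + 1 then ‖inner ℂ (weightedExp μ R l α ω c) v‖ₑ ^ 2 else 0
  rw [tsum_isCycleWord_eq_hitProb_mul hR hB hc] at hcount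
  simp only [List.length_nil, zero_le, if_true, weightedExp_nil, List.length_cons,
    Nat.add_le_add_iff_right, ← inner_weightedExp_transfer hR hB hμ hc] at hcount
  have hfin : hitProb R B l α c (n + 1) c * E ≠ ∞ :=
    ENNReal.mul_ne_top (ne_top_of_le_ne_top ENNReal.one_ne_top (hreturn ▸ le_self_add))
      (ENNReal.pow_ne_top enorm_ne_top)
  refine (ENNReal.add_left_inj hfin).1 (hcount.symm.trans ?_)
  rw [add_assoc, ← add_mul, add_comm _ (hitProb R B l α c (n + 1) c), hreturn, one_mul, add_comm]
  rfl

theorem IsMinimalFiniteInvariantSet.tsum_Omega0_eq_sum_transfer {S : Set ℝ}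
    (hS : IsMinimalFiniteInvariantSet R B l α S) (hR : R ≠ 0) (hB : 0 ∈ B)
    (hμ : IsInvariantMeasure R B μ) (hν : IsStochastic R B l α) {c : ℝ} (hc : c ∈ S)
    (v : Lp ℂ 2 μ) :
    ∑' ω : Omega0 R B l α c, ‖inner ℂ (weightedExp μ R l α ω.1 c) v‖ₑ ^ 2 =
      ∑ i, ∑' ω : Omega0 R B l α c,
        ‖inner ℂ (weightedExp μ R l α ω.1 c) (transfer hμ l α i v)‖ₑ ^ 2 := by
  have hE : ‖inner ℂ (expLp μ c) v‖ₑ ^ 2 ≠ ∞ := ENNReal.pow_ne_top enorm_ne_top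
  have havoid : Tendsto (fun n => (avoid R B l α c (n + 1) c : ℝ≥0∞) *
      ‖inner ℂ (expLp μ c) v‖ₑ ^ 2) atTop (𝓝 0) := by
    simpa using ENNReal.Tendsto.mul_const (ENNReal.tendsto_coe.2
      ((hS.tendsto_avoid hν hc hc).comp (tendsto_add_atTop_nat 1))) (.inr hE)
  have hsucc : ∀ n, frameSum R B l α c (n + 1) v = _ := fun n =>
    frameSum_succ hR ⟨0, hB⟩ hμ hν (hS.isDual hR hB hν hc) n v
  refine tendsto_nhds_unique ((tendsto_frameSum c v).comp (tendsto_add_atTop_nat 1)) ?_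
  simpa [Function.comp_def, hsucc] using
    (tendsto_finsetSum _ fun i _ => tendsto_frameSum c (transfer hμ l α i v)).add havoid

/-- The part of the energy of `v` on `F \ {c}` that has not been absorbed at `c` by time `n`. -/
noncomputable def residual (R : ℤ) (B : Finset ℤ) {m : ℕ} (l : Fin m → ℤ) (α : Fin m → ℂ)
    (F : Finset ℝ) (c : ℝ) (n : ℕ) (v : Lp ℂ 2 μ) : ℝ≥0∞ :=
  ∑ x ∈ F.erase c, avoid R B l α c n x * ‖inner ℂ (expLp μ x) v‖ₑ ^ 2

theorem sum_ite_mem_comp_le_sum {ι κ : Type*} [DecidableEq κ] {φ : ι → κ}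
    (hφ : Function.Injective φ) (s : Finset ι) (t : Finset κ) (w : κ → ℝ≥0∞) :
    ∑ i ∈ s, (if φ i ∈ t then w (φ i) else 0) ≤ ∑ k ∈ t, w k := by
  rw [← Finset.sum_filter, ← Finset.sum_image (g := φ) (f := w) hφ.injOn]
  exact Finset.sum_le_sum_of_subset fun k hk => by
    obtain ⟨i, hi, rfl⟩ := Finset.mem_image.1 hk
    exact (Finset.mem_filter.1 hi).2

theorem g_injective (hR : R ≠ 0) (i : Fin m) : Function.Injective (g R l i) :=
  gWord_injective hR [i]

namespace IsMinimalFiniteInvariantSet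

variable {S : Set ℝ}

theorem sum_avoid_succ_le (hS : IsMinimalFiniteInvariantSet R B l α S) (hR : R ≠ 0) (hB : 0 ∈ B)
    (hμ : IsInvariantMeasure R B μ) (hν : IsStochastic R B l α) (c : ℝ) (n : ℕ) (v : Lp ℂ 2 μ) :
    ∑ y ∈ hS.finite.toFinset, avoid R B l α c (n + 1) y * ‖inner ℂ (expLp μ y) v‖ₑ ^ 2 ≤
      ∑ i, residual R B l α hS.finite.toFinset c n (transfer hμ l α i v) := by
  simp only [avoid, ENNReal.ofNNReal_finsetSum, Finset.sum_mul]
  rw [Finset.sum_comm]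
  refine Finset.sum_le_sum fun i _ => le_trans (Finset.sum_le_sum fun y hy => ?_)
    (sum_ite_mem_comp_le_sum (g_injective (l := l) hR i) hS.finite.toFinset _ _)
  rw [Set.Finite.mem_toFinset] at hy
  by_cases hi : nu R B l α i y = 0
  · simp [hi]
  have hgS := hS.isInvariantSet y hy i hi
  by_cases hgc : g R l i y = c
  · simp [hgc]
  rw [if_neg hgc, if_pos (Finset.mem_erase.2 ⟨hgc, hS.finite.mem_toFinset.2 hgS⟩),
    ← enorm_nu_mul_inner_expLp hR ⟨0, hB⟩ hμ (hS.isDual hR hB hν hgS), ENNReal.coe_mul,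
    ENNReal.coe_pow, ← enorm_eq_nnnorm, mul_pow]
  exact (by ring : _ = _).le

theorem frameSum_add_residual_succ_le (hS : IsMinimalFiniteInvariantSet R B l α S) (hR : R ≠ 0)
    (hB : 0 ∈ B) (hμ : IsInvariantMeasure R B μ) (hν : IsStochastic R B l α) {c : ℝ} (hc : c ∈ S)
    (n : ℕ) (v : Lp ℂ 2 μ) :
    frameSum R B l α c (n + 1) v + residual R B l α hS.finite.toFinset c (n + 1) v ≤
      ∑ i, (frameSum R B l α c n (transfer hμ l α i v) +
        residual R B l α hS.finite.toFinset c n (transfer hμ l α i v)) := by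
  rw [frameSum_succ hR ⟨0, hB⟩ hμ hν (hS.isDual hR hB hν hc), add_assoc, residual,
    Finset.add_sum_erase _ (fun x => (avoid R B l α c (n + 1) x : ℝ≥0∞) *
      ‖inner ℂ (expLp μ x) v‖ₑ ^ 2) (hS.finite.mem_toFinset.2 hc), Finset.sum_add_distrib]
  gcongr
  exact hS.sum_avoid_succ_le hR hB hμ hν c n v

theorem frameSum_add_residual_zero (hS : IsMinimalFiniteInvariantSet R B l α S) {c : ℝ} (hc : c ∈ S)
    (v : Lp ℂ 2 μ) :
    frameSum R B l α c 0 v + residual R B l α hS.finite.toFinset c 0 v =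
      ∑ x ∈ hS.finite.toFinset, ‖inner ℂ (expLp μ x) v‖ₑ ^ 2 := by
  simp only [residual, frameSum_zero, avoid, ENNReal.coe_one, one_mul]
  exact Finset.add_sum_erase _ (fun x => ‖inner ℂ (expLp μ x) v‖ₑ ^ 2) (hS.finite.mem_toFinset.2 hc)

end IsMinimalFiniteInvariantSet

theorem IsInvariantSet.sum_enorm_inner_expLp_le {F : Finset ℝ}
    (hF : IsInvariantSet R B l α (F : Set ℝ)) (hR : 1 < |R|) (hB : 0 ∈ B)
    (hμ : IsInvariantMeasure R B μ) (hν : IsStochastic R B l α) (v : Lp ℂ 2 μ) :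
    ∑ x ∈ F, ‖inner ℂ (expLp μ x) v‖ₑ ^ 2 ≤ ‖v‖ₑ ^ 2 := by
  have horth : Orthonormal ℂ fun x : F => expLp μ x :=
    ⟨fun x => norm_expLp _, fun x y hxy => hF.inner_expLp_eq_zero F.finite_toSet hR hB hμ hν
      x.2 y.2 (Subtype.coe_ne_coe.2 hxy)⟩
  have h : ∑ x ∈ F, ‖inner ℂ (expLp μ x) v‖₊ ^ 2 ≤ ‖v‖₊ ^ 2 := by
    rw [← NNReal.coe_le_coe, ← Finset.sum_coe_sort F]
    simpa using horth.sum_inner_products_le v (s := Finset.univ)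
  simp only [enorm_eq_nnnorm]
  exact_mod_cast h

section Bessel

variable [Fintype {S : Set ℝ // IsMinimalFiniteInvariantSet R B l α S}]

theorem sum_sum_enorm_inner_expLp_le (hR : 1 < |R|) (hB : 0 ∈ B) (hμ : IsInvariantMeasure R B μ)
    (hν : IsStochastic R B l α) (v : Lp ℂ 2 μ) :
    ∑ S : {S : Set ℝ // IsMinimalFiniteInvariantSet R B l α S},
      ∑ x ∈ S.2.finite.toFinset, ‖inner ℂ (expLp μ x) v‖ₑ ^ 2 ≤ ‖v‖ₑ ^ 2 := by
  rw [← Finset.sum_biUnion fun S _ S' _ hne => ?disjoint]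
  · refine IsInvariantSet.sum_enorm_inner_expLp_le (fun t ht i hi => ?_) hR hB hμ hν v
    simp only [Finset.coe_biUnion, Set.mem_iUnion, Finset.mem_coe, Set.Finite.mem_toFinset]
      at ht ⊢
    obtain ⟨S, hS, htS⟩ := ht
    exact ⟨S, hS, S.2.isInvariantSet t htS i hi⟩
  · rw [Function.onFun, Finset.disjoint_left]
    intro x hx hx'
    exact hne (Subtype.ext (S.2.eq_of_mem S'.2 (S.2.finite.mem_toFinset.1 hx)
      (S'.2.finite.mem_toFinset.1 hx')))

theorem sum_frameSum_le (hR : 1 < |R|) (hB : 0 ∈ B) (hμ : IsInvariantMeasure R B μ)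
    (hiso : (weightedMatrix R B l α).conjTranspose * weightedMatrix R B l α = 1)
    {c : {S : Set ℝ // IsMinimalFiniteInvariantSet R B l α S} → ℝ} (hc : ∀ S, c S ∈ S.1)
    (n : ℕ) (v : Lp ℂ 2 μ) : ∑ S, frameSum R B l α (c S) n v ≤ ‖v‖ₑ ^ 2 := by
  have hR0 : R ≠ 0 := by rintro rfl; simp at hR
  have hν := isStochastic_of_isometry ⟨0, hB⟩ hiso
  suffices h : ∑ S, (frameSum R B l α (c S) n v +
      residual R B l α S.2.finite.toFinset (c S) n v) ≤ ‖v‖ₑ ^ 2 from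
    (Finset.sum_le_sum fun S _ => le_self_add).trans h
  induction n generalizing v with
  | zero =>
    refine (Finset.sum_congr rfl fun S _ => S.2.frameSum_add_residual_zero (hc S) v).trans_le ?_
    exact sum_sum_enorm_inner_expLp_le hR hB hμ hν v
  | succ n ih =>
    calc _ ≤ ∑ S, ∑ i, _ := Finset.sum_le_sum fun S _ =>
          S.2.frameSum_add_residual_succ_le hR0 hB hμ hν (hc S) n v
      _ = ∑ i, ∑ S, _ := Finset.sum_comm
      _ ≤ ∑ i, ‖transfer hμ l α i v‖ₑ ^ 2 := Finset.sum_le_sum fun i _ => ih _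
      _ = ‖v‖ₑ ^ 2 := sum_enorm_sq_transfer ⟨0, hB⟩ hμ hiso v

theorem sum_tsum_Omega0_le (hR : 1 < |R|) (hB : 0 ∈ B) (hμ : IsInvariantMeasure R B μ)
    (hiso : (weightedMatrix R B l α).conjTranspose * weightedMatrix R B l α = 1)
    {c : {S : Set ℝ // IsMinimalFiniteInvariantSet R B l α S} → ℝ} (hc : ∀ S, c S ∈ S.1)
    (v : Lp ℂ 2 μ) :
    ∑ S, ∑' ω : Omega0 R B l α (c S), ‖inner ℂ (weightedExp μ R l α ω.1 (c S)) v‖ₑ ^ 2 ≤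
      ‖v‖ₑ ^ 2 :=
  le_of_tendsto' (tendsto_finsetSum _ fun S _ => tendsto_frameSum (c S) v)
    fun n => sum_frameSum_le hR hB hμ hiso hc n v

end Bessel

/-! ### Harmonic functions -/

/-- `d` is harmonic for the random walk that moves from `t` to `g_i(t)` with probability
`|ν_i(t)|²`. -/
def IsHarmonic (R : ℤ) (B : Finset ℤ) {m : ℕ} (l : Fin m → ℤ) (α : Fin m → ℂ) (d : ℝ → ℝ) : Prop :=
  ∀ t, d t = ∑ i, ‖nu R B l α i t‖ ^ 2 * d (g R l i t)

theorem IsHarmonic.isInvariantSet_setOf_eq_max {d : ℝ → ℝ} (hd : IsHarmonic R B l α d)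
    (hν : IsStochastic R B l α) {K : Set ℝ} (hK : IsInvariantSet R B l α K) {M : ℝ}
    (hM : ∀ t ∈ K, d t ≤ M) : IsInvariantSet R B l α {t ∈ K | d t = M} := by
  rintro t ⟨ht, hdt⟩ i hi
  exact ⟨hK t ht i hi, eq_of_sum_mul_eq (fun _ => sq_nonneg _) (hν.sum_norm_sq t)
    (fun j hj => hM _ (hK t ht j fun h => hj (by simp [h]))) ((hd t).symm.trans hdt)
    (pow_ne_zero 2 (norm_ne_zero_iff.2 hi))⟩

theorem isInvariantSet_Icc (hR : 1 < |R|) {L : ℝ} (hL : ∀ i, |(l i : ℝ)| ≤ L) :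
    IsInvariantSet R B l α (Set.Icc (-L) L) := fun t ht i _ => by
  have hg := abs_g_le hR (hL i) t
  have := abs_le.2 ht
  exact abs_le.1 (by linarith)

theorem IsHarmonic.nonpos_of_analytic {d : ℝ → ℝ} (hd : IsHarmonic R B l α d) (hR : 1 < |R|)
    (hν : IsStochastic R B l α) (hda : AnalyticOnNhd ℝ d Set.univ)
    (hzero : ∀ S, IsMinimalFiniteInvariantSet R B l α S → ∃ x ∈ S, d x = 0)
    (hex : ∃ S, IsMinimalFiniteInvariantSet R B l α S) (t : ℝ) : d t ≤ 0 := by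
  obtain ⟨L, hL⟩ := Finite.exists_le fun i => |(l i : ℝ)|
  set K := Set.Icc (-max L |t|) (max L |t|)
  have hK : IsInvariantSet R B l α K :=
    isInvariantSet_Icc hR fun i => (hL i).trans (le_max_left _ _)
  have ht : t ∈ K := abs_le.1 (le_max_right _ _)
  have hcont : ContinuousOn d K := hda.continuousOn.mono (Set.subset_univ K)
  obtain ⟨z, hz, hmax⟩ := isCompact_Icc.exists_isMaxOn ⟨t, ht⟩ hcont
  suffices hdz : d z = 0 from hdz ▸ hmax ht
  by_cases hfin : {x ∈ K | d x = d z}.Finite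
  · obtain ⟨S, hSZ, hS⟩ := (hd.isInvariantSet_setOf_eq_max hν hK
      fun x hx => hmax hx).exists_minimal_subset hfin ⟨z, hz, rfl⟩
    obtain ⟨x, hx, hx0⟩ := hzero S hS
    exact (hSZ hx).2.symm.trans hx0
  · obtain ⟨S, hS⟩ := hex
    obtain ⟨x, -, hx0⟩ := hzero S hS
    exact (eq_const_of_infinite_level_set hda isCompact_Icc hfin x).symm.trans hx0

/-! ### The Parseval property -/

/-- The family of the weighted exponentials `weightedExp μ R l α ω (c S)` with `ω ∈ Ω_{c S}^{(0)}`,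
where `S` runs through the minimal finite invariant sets. -/
noncomputable def exponentialFamily (μ : Measure ℝ) [IsFiniteMeasure μ]
    (c : {S : Set ℝ // IsMinimalFiniteInvariantSet R B l α S} → ℝ)
    (p : (S : {S : Set ℝ // IsMinimalFiniteInvariantSet R B l α S}) × Omega0 R B l α (c S)) :
    Lp ℂ 2 μ :=
  weightedExp μ R l α p.2.1 (c p.1)

variable {c : {S : Set ℝ // IsMinimalFiniteInvariantSet R B l α S} → ℝ}

theorem tsum_exponentialFamily_le (hR : 1 < |R|) (hB : 0 ∈ B) (hμ : IsInvariantMeasure R B μ)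
    (hiso : (weightedMatrix R B l α).conjTranspose * weightedMatrix R B l α = 1)
    (hc : ∀ S, c S ∈ S.1) (v : Lp ℂ 2 μ) :
    ∑' p, ‖inner ℂ (exponentialFamily μ c p) v‖ₑ ^ 2 ≤ ‖v‖ₑ ^ 2 := by
  have hfin := finite_setOf_isMinimalFiniteInvariantSet hR hB hμ
    (isStochastic_of_isometry ⟨0, hB⟩ hiso)
  let : Fintype {S : Set ℝ // IsMinimalFiniteInvariantSet R B l α S} := hfin.fintype
  rw [ENNReal.tsum_sigma', tsum_fintype]
  exact sum_tsum_Omega0_le hR hB hμ hiso hc v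

theorem tsum_exponentialFamily_eq_sum_transfer (hR : R ≠ 0) (hB : 0 ∈ B)
    (hμ : IsInvariantMeasure R B μ) (hν : IsStochastic R B l α) (hc : ∀ S, c S ∈ S.1)
    (v : Lp ℂ 2 μ) :
    ∑' p, ‖inner ℂ (exponentialFamily μ c p) v‖ₑ ^ 2 =
      ∑ i, ∑' p, ‖inner ℂ (exponentialFamily μ c p) (transfer hμ l α i v)‖ₑ ^ 2 := by
  simp only [ENNReal.tsum_sigma', exponentialFamily]
  rw [← Summable.tsum_finsetSum fun _ _ => ENNReal.summable]
  exact tsum_congr fun S => S.2.tsum_Omega0_eq_sum_transfer hR hB hμ hν (hc S) v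

section AnalysisOperator

variable {F : Type*} [NormedAddCommGroup F] [InnerProductSpace ℂ F] {A : Lp ℂ 2 μ →L[ℂ] F}

theorem isHarmonic_one_sub_norm_sq (hμ : IsInvariantMeasure R B μ) (hν : IsStochastic R B l α)
    (hA : ∀ v, ‖A v‖ ^ 2 = ∑ i, ‖A (transfer hμ l α i v)‖ ^ 2) :
    IsHarmonic R B l α fun t => 1 - ‖A (expLp μ t)‖ ^ 2 := fun t => by
  simp only [mul_sub, mul_one, Finset.sum_sub_distrib, hν.sum_norm_sq, hA (expLp μ t),
    transfer_expLp, map_smul, norm_smul, mul_pow]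

theorem analyticOnNhd_one_sub_norm_sq (hR : 1 < |R|) (hB : B.Nonempty)
    (hμ : IsInvariantMeasure R B μ) (A : Lp ℂ 2 μ →L[ℂ] F) :
    AnalyticOnNhd ℝ (fun t => 1 - ‖A (expLp μ t)‖ ^ 2) Set.univ := by
  obtain ⟨C, hC⟩ := Finite.exists_le fun b : B => |((b : ℤ) : ℝ)|
  have hexp := contDiff_expLp (hμ.ae_abs_le hR hB fun b hb => hC ⟨b, hb⟩)
  rw [← contDiff_omega_iff_analyticOnNhd]
  exact contDiff_const.sub (((A.restrictScalars ℝ).contDiff.comp hexp).norm_sq ℂ)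

theorem norm_map_eq_of_transfer (hR : 1 < |R|) (hB : B.Nonempty) (hμ : IsInvariantMeasure R B μ)
    (hν : IsStochastic R B l α) (hle : ∀ v, ‖A v‖ ≤ ‖v‖)
    (hA : ∀ v, ‖A v‖ ^ 2 = ∑ i, ‖A (transfer hμ l α i v)‖ ^ 2)
    (hpt : ∀ S, IsMinimalFiniteInvariantSet R B l α S → ∃ x ∈ S, ‖A (expLp μ x)‖ = 1)
    (hex : ∃ S, IsMinimalFiniteInvariantSet R B l α S) (v : Lp ℂ 2 μ) : ‖A v‖ = ‖v‖ := by
  have hzero : ∀ S, IsMinimalFiniteInvariantSet R B l α S →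
      ∃ x ∈ S, 1 - ‖A (expLp μ x)‖ ^ 2 = 0 := fun S hS => by
    obtain ⟨x, hx, h1⟩ := hpt S hS
    exact ⟨x, hx, by rw [h1]; norm_num⟩
  refine norm_map_eq_of_contraction hle topologicalClosure_span_range_expLp ?_ v
  rintro _ ⟨t, rfl⟩
  have hdefect := (isHarmonic_one_sub_norm_sq hμ hν hA).nonpos_of_analytic hR hν
    (analyticOnNhd_one_sub_norm_sq hR hB hμ A) hzero hex t
  refine le_antisymm (hle _) ?_
  rw [norm_expLp]
  exact (one_le_sq_iff₀ (norm_nonneg _)).1 (by linarith)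

end AnalysisOperator

theorem one_le_of_hasSum_exponentialFamily
    (S : {S : Set ℝ // IsMinimalFiniteInvariantSet R B l α S}) {a : ℝ}
    (h : HasSum (fun p => ‖inner ℂ (exponentialFamily μ c p) (expLp μ (c S))‖ ^ 2) a) :
    1 ≤ a := by
  have hnil := le_hasSum h ⟨S, [], nil_mem_Omega0 _⟩ fun _ _ => sq_nonneg _
  simpa [exponentialFamily, weightedExp_nil, norm_expLp] using hnil

theorem isParsevalFrame_exponentialFamily (hR : 1 < |R|) (hB : 0 ∈ B)
    (hμ : IsInvariantMeasure R B μ)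
    (hiso : (weightedMatrix R B l α).conjTranspose * weightedMatrix R B l α = 1)
    (hex : ∃ S, IsMinimalFiniteInvariantSet R B l α S) (hc : ∀ S, c S ∈ S.1) :
    IsParsevalFrame (exponentialFamily μ c) := by
  have hR0 : R ≠ 0 := by rintro rfl; simp at hR
  have hν := isStochastic_of_isometry ⟨0, hB⟩ hiso
  obtain ⟨A, hle, hsum⟩ := exists_analysis_operator (exponentialFamily μ c)
    (tsum_exponentialFamily_le hR hB hμ hiso hc)
  have hA : ∀ v, ‖A v‖ ^ 2 = ∑ i, ‖A (transfer hμ l α i v)‖ ^ 2 := fun v =>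
    (sum_enorm_sq_eq_iff.1 (by
      simpa only [← tsum_enorm_sq_of_hasSum (hsum _)] using
        (tsum_exponentialFamily_eq_sum_transfer hR0 hB hμ hν hc v).symm)).symm
  have hpt : ∀ S, IsMinimalFiniteInvariantSet R B l α S → ∃ x ∈ S, ‖A (expLp μ x)‖ = 1 :=
    fun S hS => ⟨c ⟨S, hS⟩, hc ⟨S, hS⟩, le_antisymm ((hle _).trans_eq (norm_expLp _))
      ((one_le_sq_iff₀ (norm_nonneg _)).1 (one_le_of_hasSum_exponentialFamily _ (hsum _)))⟩
  intro v
  exact norm_map_eq_of_transfer hR ⟨0, hB⟩ hμ hν hle hA hpt hex v ▸ hsum v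

end WeightedFourier

theorem corollary4p7_general (R : ℤ) (hR : 1 < |R|) (B : Finset ℤ) (hB : 0 ∈ B)
    (μ : MeasureTheory.Measure ℝ) [MeasureTheory.IsProbabilityMeasure μ]
    (hμ : WeightedFourier.IsInvariantMeasure R B μ)
    (m : ℕ) (l : Fin m → ℤ) (α : Fin m → ℂ)
    (hiso : (WeightedFourier.weightedMatrix R B l α).conjTranspose *
      WeightedFourier.weightedMatrix R B l α = 1)
    (hex : ∃ S, WeightedFourier.IsMinimalFiniteInvariantSet R B l α S)
    (c : {S : Set ℝ // WeightedFourier.IsMinimalFiniteInvariantSet R B l α S} → ℝ)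
    (hc : ∀ S, c S ∈ S.1) :
    {S : Set ℝ | WeightedFourier.IsMinimalFiniteInvariantSet R B l α S}.Finite ∧
    WeightedFourier.IsParsevalFrame
      (fun p : (S : {S : Set ℝ // WeightedFourier.IsMinimalFiniteInvariantSet R B l α S}) ×
          WeightedFourier.Omega0 R B l α (c S) =>
        WeightedFourier.weightedExp μ R l α p.2.1 (c p.1)) :=
  ⟨WeightedFourier.finite_setOf_isMinimalFiniteInvariantSet hR hB hμ
    (WeightedFourier.isStochastic_of_isometry ⟨0, hB⟩ hiso),
    WeightedFourier.isParsevalFrame_exponentialFamily hR hB hμ hiso hex hc⟩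

theorem corollary4p7 (R : ℤ) (hR : 1 < |R|) (B : Finset ℤ) (hB : 0 ∈ B)
    (μ : MeasureTheory.Measure ℝ) [MeasureTheory.IsProbabilityMeasure μ]
    (hμ : WeightedFourier.IsInvariantMeasure R B μ)
    (m : ℕ) [NeZero m] (l : Fin m → ℤ) (hl : l 0 = 0) (α : Fin m → ℂ) (hα : α 0 = 1)
    (hiso : (WeightedFourier.weightedMatrix R B l α).conjTranspose *
      WeightedFourier.weightedMatrix R B l α = 1)
    (c : {S : Set ℝ // WeightedFourier.IsMinimalFiniteInvariantSet R B l α S} → ℝ)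
    (hc : ∀ S, c S ∈ S.1) :
    {S : Set ℝ | WeightedFourier.IsMinimalFiniteInvariantSet R B l α S}.Finite ∧
    WeightedFourier.IsParsevalFrame
      (fun p : (S : {S : Set ℝ // WeightedFourier.IsMinimalFiniteInvariantSet R B l α S}) ×
          WeightedFourier.Omega0 R B l α (c S) =>
        WeightedFourier.weightedExp μ R l α p.2.1 (c p.1)) :=
  corollary4p7_general R hR B hB μ hμ m l α hiso ⟨{0}, WeightedFourier.isMinimal_singleton_zero
    ⟨0, hB⟩ hl hα (WeightedFourier.isStochastic_of_isometry ⟨0, hB⟩ hiso)⟩ c hc
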